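/- **Local bifurcation on the square lattice.** Let $g>0$ and $k_0>0$, let $\square=(-\pi/k_0,\pi/k_0)^2$, and let $D_4$ be the symmetry group of this square. Let $$\mathcal X=\Big\{v\in \mathrm H^2_{\mathrm{per}}(\square): v \text{ is } D_4\text{-invariant},\ \frac1{|\square|}\int_\square v\,\mathrm dx=0\Big\},\qquad \mathcal U=\{v\in\mathcal X: v>-1\},$$ where $\mathrm H^2_{\mathrm{per}}(\square)$ is the Sobolev space of real functions on $\mathbb R^2$ that are $2\pi/k_0$-periodic in both coordinates and $\mathcal X$ carries its norm $\|v\|_{\mathcal X}^2=\sum_{|\alpha|\le2}\int_\square|\partial^\alpha v|^2\,\mathrm dx$. For $v\in\mathcal U$, $M\in\mathbb R$ let $$F(v,M)=\Delta v-gv+M\Big(\frac1{2+v}+\log\frac{1+v}{2+v}\Big)-MK(v),\qquad K(v)=\frac1{|\square|}\int_\square\Big(\frac1{2+v}+\log\frac{1+v}{2+v}\Big)\mathrm dx ,$$ so that $F(0,M)=0$ for all $M$. Let $M^*(k_0)=4g+4k_0^2$, $\xi_0(x,y)=\mathrm e^{\mathrm ik_0x}+\mathrm e^{-\mathrm ik_0x}+\mathrm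 e^{\mathrm ik_0y}+\mathrm e^{-\mathrm ik_0y}$ and $\hat\xi_0=\xi_0/\|\xi_0\|_{\mathcal X}$. Then the problem $F(v,M)=0$ has a subcritical pitchfork bifurcation at $(0,M^*(k_0))$: there are $\varepsilon>0$ and a continuous branch of solutions $\{(v(s),M(s)):s\in(-\varepsilon,\varepsilon)\}\subset\mathcal U\times\mathbb R$ of $F(v(s),M(s))=0$ with $(v(0),M(0))=(0,M^*(k_0))$, with $v(s)\neq0$ and $M(s)<M^*(k_0)$ for $s\ne0$, and with the expansions, as $s\to0$, $$v(s)=s\,\hat\xi_0+\tau(s),\quad \tau(s)=\mathcal O(|s|^2)\ \text{in } \mathcal X,\qquad M(s)=M^*(k_0)-\frac{(g+k_0^2)(104\,g+203\,k_0^2)}{48\pi^2(1+k_0^2+k_0^4)}\,s^2+\mathcal O(|s|^3).$$ -/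

import Mathlib

open MeasureTheory Set Filter Topology Asymptotics

noncomputable section

namespace ThinFilm

/-! ### The square cell, periodicity, and the symmetry group `D₄` -/

/-- The square fundamental domain with side `2π / k₀`, centred at the origin. -/
def cell (k₀ : ℝ) : Set (ℝ × ℝ) :=
  Ioo (-(Real.pi / k₀)) (Real.pi / k₀) ×ˢ Ioo (-(Real.pi / k₀)) (Real.pi / k₀)

/-- Lebesgue measure on the square cell. -/
def cellMeasure (k₀ : ℝ) : Measure (ℝ × ℝ) := volume.restrict (cell k₀)

/-- Square-periodicity with absolute wave number `k₀`. -/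
def SquarePeriodic (k₀ : ℝ) (u : ℝ × ℝ → ℝ) : Prop :=
  ∀ p : ℝ × ℝ, u (p.1 + 2 * Real.pi / k₀, p.2) = u p ∧ u (p.1, p.2 + 2 * Real.pi / k₀) = u p

/-- Rotation of the plane by a quarter turn. -/
def quarterTurn : Equiv.Perm (ℝ × ℝ) where
  toFun p := (-p.2, p.1)
  invFun p := (p.2, -p.1)
  left_inv p := by simp
  right_inv p := by simp

/-- Reflection of the plane at the first coordinate axis. -/
def axisReflection : Equiv.Perm (ℝ × ℝ) where
  toFun p := (p.1, -p.2)
  invFun p := (p.1, -p.2)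
  left_inv p := by simp
  right_inv p := by simp

/-- The dihedral group `D₄` of symmetries of the square, acting on the plane. -/
def squareGroup : Subgroup (Equiv.Perm (ℝ × ℝ)) :=
  Subgroup.closure {quarterTurn, axisReflection}

/-! ### Lebesgue and Sobolev spaces of periodic functions -/

/-- `L²_per(□)`: a square-periodic function is determined by its restriction to the cell. -/
abbrev L2per (k₀ : ℝ) : Type := Lp ℝ 2 (cellMeasure k₀)

/-- Invariance under `D₄` (which maps the centred cell onto itself). -/
def SquareSymmetric (k₀ : ℝ) (v : L2per k₀) : Prop :=
  ∀ S ∈ squareGroup, (fun p => v (S p)) =ᵐ[cellMeasure k₀] v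

/-- Classical partial derivative in the first variable. -/
def pderivX (φ : ℝ × ℝ → ℝ) : ℝ × ℝ → ℝ := fun p => deriv (fun t => φ (t, p.2)) p.1

/-- Classical partial derivative in the second variable. -/
def pderivY (φ : ℝ × ℝ → ℝ) : ℝ × ℝ → ℝ := fun p => deriv (fun t => φ (p.1, t)) p.2

/-- The multi-indices `α = (α₁, α₂)` with `|α| ≤ 2`. -/
abbrev MultiIdx : Type := {α : Fin 3 × Fin 3 // (α.1 : ℕ) + (α.2 : ℕ) ≤ 2}

/-- The classical derivative `∂^α φ`. -/
def classicalDeriv (α : MultiIdx) (φ : ℝ × ℝ → ℝ) : ℝ × ℝ → ℝ :=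
  pderivX^[(α.1.1 : ℕ)] (pderivY^[(α.1.2 : ℕ)] φ)

/-- `w` is the weak derivative `∂^α v` of the periodic function `v`: the test functions are the
smooth square-periodic functions. -/
def IsWeakDeriv (k₀ : ℝ) (α : MultiIdx) (v w : L2per k₀) : Prop :=
  ∀ φ : ℝ × ℝ → ℝ, ContDiff ℝ (⊤ : ℕ∞) φ → SquarePeriodic k₀ φ →
    ∫ p, v p * classicalDeriv α φ p ∂(cellMeasure k₀)
      = (-1) ^ ((α.1.1 : ℕ) + (α.1.2 : ℕ)) * ∫ p, w p * φ p ∂(cellMeasure k₀)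

/-- Families `(w_α)`, `|α| ≤ 2`, of functions in `L²_per(□)`, with the norm
`(∑_{|α| ≤ 2} ‖w_α‖²)^{1/2}`. -/
abbrev JetSpace (k₀ : ℝ) : Type := PiLp 2 (fun _ : MultiIdx => L2per k₀)

/-- The index of the function itself. -/
def idx0 : MultiIdx := ⟨(0, 0), by decide⟩

/-- The index of `∂ₓ²`. -/
def idxXX : MultiIdx := ⟨(2, 0), by decide⟩

/-- The index of `∂_y²`. -/
def idxYY : MultiIdx := ⟨(0, 2), by decide⟩

/-! ### Facts needed for the linear structure of the spaces -/

lemma measurableSet_cell (k₀ : ℝ) : MeasurableSet (cell k₀) :=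
  measurableSet_Ioo.prod measurableSet_Ioo

lemma cell_subset (k₀ : ℝ) : cell k₀ ⊆
    Icc (-(Real.pi / k₀)) (Real.pi / k₀) ×ˢ Icc (-(Real.pi / k₀)) (Real.pi / k₀) :=
  prod_mono Ioo_subset_Icc_self Ioo_subset_Icc_self

instance instFiniteCell (k₀ : ℝ) : IsFiniteMeasure (cellMeasure k₀) := by
  constructor
  rw [cellMeasure, Measure.restrict_apply_univ]
  exact lt_of_le_of_lt (measure_mono (cell_subset k₀))
    (isCompact_Icc.prod isCompact_Icc).measure_lt_top

lemma memLp_of_continuous (k₀ : ℝ) {u : ℝ × ℝ → ℝ} (hu : Continuous u) :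
    MemLp u 2 (cellMeasure k₀) := by
  obtain ⟨C, hC⟩ := (isCompact_Icc.prod isCompact_Icc).exists_bound_of_continuousOn
    (s := Icc (-(Real.pi / k₀)) (Real.pi / k₀) ×ˢ Icc (-(Real.pi / k₀)) (Real.pi / k₀))
    hu.continuousOn
  refine MemLp.of_bound hu.aestronglyMeasurable C ?_
  refine (ae_restrict_iff' (measurableSet_cell k₀)).2 (Eventually.of_forall fun p hp => ?_)
  exact hC p (cell_subset k₀ hp)

lemma integrable_mul_continuous (k₀ : ℝ) (v : L2per k₀) {u : ℝ × ℝ → ℝ} (hu : Continuous u) :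
    Integrable (fun p => v p * u p) (cellMeasure k₀) :=
  (Lp.memLp v).integrable_mul (memLp_of_continuous k₀ hu)

lemma integrable_L2per (k₀ : ℝ) (v : L2per k₀) : Integrable v (cellMeasure k₀) :=
  (Lp.memLp v).integrable (by norm_num)

lemma contDiff_pderivX {φ : ℝ × ℝ → ℝ} (h : ContDiff ℝ (⊤ : ℕ∞) φ) :
    ContDiff ℝ (⊤ : ℕ∞) (pderivX φ) := by
  have : pderivX φ = fun p => fderiv ℝ φ p (1, 0) := by
    funext p
    have hd : HasFDerivAt φ (fderiv ℝ φ p) (p.1, p.2) :=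
      (h.differentiable (by simp) p).hasFDerivAt
    exact (hd.comp_hasDerivAt p.1 ((hasDerivAt_id p.1).prodMk (hasDerivAt_const p.1 p.2))).deriv
  rw [this]
  exact (h.fderiv_right (by simp)).clm_apply contDiff_const

lemma contDiff_pderivY {φ : ℝ × ℝ → ℝ} (h : ContDiff ℝ (⊤ : ℕ∞) φ) :
    ContDiff ℝ (⊤ : ℕ∞) (pderivY φ) := by
  have : pderivY φ = fun p => fderiv ℝ φ p (0, 1) := by
    funext p
    have hd : HasFDerivAt φ (fderiv ℝ φ p) (p.1, p.2) :=
      (h.differentiable (by simp) p).hasFDerivAt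
    exact (hd.comp_hasDerivAt p.2 ((hasDerivAt_const p.2 p.1).prodMk (hasDerivAt_id p.2))).deriv
  rw [this]
  exact (h.fderiv_right (by simp)).clm_apply contDiff_const

lemma contDiff_classicalDeriv (α : MultiIdx) {φ : ℝ × ℝ → ℝ} (h : ContDiff ℝ (⊤ : ℕ∞) φ) :
    ContDiff ℝ (⊤ : ℕ∞) (classicalDeriv α φ) := by
  have hY : ∀ n : ℕ, ContDiff ℝ (⊤ : ℕ∞) (pderivY^[n] φ) := fun n => by
    induction n with
    | zero => exact h
    | succ n ih => rw [Function.iterate_succ_apply']; exact contDiff_pderivY ih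
  have hX : ∀ n : ℕ, ContDiff ℝ (⊤ : ℕ∞) (pderivX^[n] (pderivY^[(α.1.2 : ℕ)] φ)) := fun n => by
    induction n with
    | zero => exact hY _
    | succ n ih => rw [Function.iterate_succ_apply']; exact contDiff_pderivX ih
  exact hX _

lemma integral_add_mul (k₀ : ℝ) (v w : L2per k₀) {u : ℝ × ℝ → ℝ} (hu : Continuous u) :
    ∫ p, (v + w : L2per k₀) p * u p ∂(cellMeasure k₀)
      = ∫ p, v p * u p ∂(cellMeasure k₀) + ∫ p, w p * u p ∂(cellMeasure k₀) := by
  rw [← integral_add (integrable_mul_continuous k₀ v hu) (integrable_mul_continuous k₀ w hu)]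
  refine integral_congr_ae ?_
  filter_upwards [Lp.coeFn_add v w] with p hp
  rw [hp, Pi.add_apply, add_mul]

lemma integral_smul_mul (k₀ c : ℝ) (v : L2per k₀) (u : ℝ × ℝ → ℝ) :
    ∫ p, (c • v : L2per k₀) p * u p ∂(cellMeasure k₀)
      = c * ∫ p, v p * u p ∂(cellMeasure k₀) := by
  rw [← integral_const_mul]
  refine integral_congr_ae ?_
  filter_upwards [Lp.coeFn_smul c v] with p hp
  rw [hp, Pi.smul_apply, smul_eq_mul, mul_assoc]

lemma IsWeakDeriv.add {k₀ : ℝ} {α : MultiIdx} {v w v' w' : L2per k₀}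
    (h : IsWeakDeriv k₀ α v w) (h' : IsWeakDeriv k₀ α v' w') :
    IsWeakDeriv k₀ α (v + v') (w + w') := by
  intro φ hφ hp
  rw [integral_add_mul k₀ v v' (contDiff_classicalDeriv α hφ).continuous,
    integral_add_mul k₀ w w' hφ.continuous, h φ hφ hp, h' φ hφ hp, mul_add]

lemma IsWeakDeriv.smul {k₀ : ℝ} {α : MultiIdx} {v w : L2per k₀} (c : ℝ)
    (h : IsWeakDeriv k₀ α v w) : IsWeakDeriv k₀ α (c • v) (c • w) := by
  intro φ hφ hp
  rw [integral_smul_mul, integral_smul_mul, h φ hφ hp]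
  ring

lemma measurePreserving_of_mem_squareGroup (k₀ : ℝ) {S : Equiv.Perm (ℝ × ℝ)}
    (hS : S ∈ squareGroup) : MeasurePreserving S (cellMeasure k₀) (cellMeasure k₀) := by
  have hneg : MeasurePreserving (fun x : ℝ => -x) volume volume :=
    Measure.measurePreserving_neg volume
  have hq : MeasurePreserving (fun p : ℝ × ℝ => ((-p.2, p.1) : ℝ × ℝ)) volume volume :=
    (hneg.prod (MeasurePreserving.id volume)).comp Measure.measurePreserving_swap
  have hq' : MeasurePreserving (fun p : ℝ × ℝ => ((p.2, -p.1) : ℝ × ℝ)) volume volume :=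
    ((MeasurePreserving.id volume).prod hneg).comp Measure.measurePreserving_swap
  have hr : MeasurePreserving (fun p : ℝ × ℝ => ((p.1, -p.2) : ℝ × ℝ)) volume volume :=
    (MeasurePreserving.id volume).prod hneg
  have key : ∀ f : ℝ × ℝ → ℝ × ℝ, MeasurePreserving f volume volume →
      f ⁻¹' cell k₀ = cell k₀ → MeasurePreserving f (cellMeasure k₀) (cellMeasure k₀) := by
    intro f hf h
    have := hf.restrict_preimage (measurableSet_cell k₀)
    rwa [h] at this
  have e1 : (fun p : ℝ × ℝ => ((-p.2, p.1) : ℝ × ℝ)) ⁻¹' cell k₀ = cell k₀ := by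
    ext ⟨x, y⟩
    simp only [cell, mem_preimage, mem_prod, mem_Ioo]
    constructor <;> rintro ⟨⟨_, _⟩, _, _⟩ <;> refine ⟨⟨?_, ?_⟩, ?_, ?_⟩ <;> linarith
  have e2 : (fun p : ℝ × ℝ => ((p.2, -p.1) : ℝ × ℝ)) ⁻¹' cell k₀ = cell k₀ := by
    ext ⟨x, y⟩
    simp only [cell, mem_preimage, mem_prod, mem_Ioo]
    constructor <;> rintro ⟨⟨_, _⟩, _, _⟩ <;> refine ⟨⟨?_, ?_⟩, ?_, ?_⟩ <;> linarith
  have e3 : (fun p : ℝ × ℝ => ((p.1, -p.2) : ℝ × ℝ)) ⁻¹' cell k₀ = cell k₀ := by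
    ext ⟨x, y⟩
    simp only [cell, mem_preimage, mem_prod, mem_Ioo]
    constructor <;> rintro ⟨⟨_, _⟩, _, _⟩ <;> refine ⟨⟨?_, ?_⟩, ?_, ?_⟩ <;> linarith
  have hboth : MeasurePreserving S (cellMeasure k₀) (cellMeasure k₀) ∧
      MeasurePreserving (S⁻¹ : Equiv.Perm (ℝ × ℝ)) (cellMeasure k₀) (cellMeasure k₀) := by
    induction hS using Subgroup.closure_induction with
    | mem x hx =>
      rcases hx with rfl | rfl
      · exact ⟨key _ hq e1, key _ hq' e2⟩
      · exact ⟨key _ hr e3, key _ hr e3⟩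
    | one => exact ⟨MeasurePreserving.id _, by rw [inv_one]; exact MeasurePreserving.id _⟩
    | mul x y _ _ hx hy =>
      refine ⟨hx.1.comp hy.1, ?_⟩
      rw [mul_inv_rev]
      exact hy.2.comp hx.2
    | inv x _ hx => exact ⟨hx.2, by rw [inv_inv]; exact hx.1⟩
  exact hboth.1

lemma SquareSymmetric.add {k₀ : ℝ} {v w : L2per k₀} (hv : SquareSymmetric k₀ v)
    (hw : SquareSymmetric k₀ w) : SquareSymmetric k₀ (v + w) := by
  intro S hS
  have h := Lp.coeFn_add v w
  have h' := (measurePreserving_of_mem_squareGroup k₀ hS).quasiMeasurePreserving.ae h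
  filter_upwards [h, h', hv S hS, hw S hS] with p h1 h2 h3 h4
  rw [h1, h2, Pi.add_apply, Pi.add_apply, h3, h4]

lemma SquareSymmetric.smul {k₀ : ℝ} {v : L2per k₀} (c : ℝ) (hv : SquareSymmetric k₀ v) :
    SquareSymmetric k₀ (c • v) := by
  intro S hS
  have h := Lp.coeFn_smul c v
  have h' := (measurePreserving_of_mem_squareGroup k₀ hS).quasiMeasurePreserving.ae h
  filter_upwards [h, h', hv S hS] with p h1 h2 h3
  rw [h1, h2, Pi.smul_apply, Pi.smul_apply, h3]

/-! ### The spaces of the bifurcation problem -/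

/-- The space `𝒳` of square-symmetric functions `v ∈ H²_per(□)` with vanishing mean. A function
`v` is represented by the family of its weak derivatives `(∂^α v)`, `|α| ≤ 2`, which it
determines; the inherited norm is the `H²_per(□)`-norm. -/
def X (k₀ : ℝ) : Submodule ℝ (JetSpace k₀) where
  carrier := {w | (∀ α, IsWeakDeriv k₀ α (w idx0) (w α)) ∧ SquareSymmetric k₀ (w idx0) ∧
    ⨍ p, (w idx0) p ∂(cellMeasure k₀) = 0}
  add_mem' := by
    rintro v w ⟨h1, h2, h3⟩ ⟨h1', h2', h3'⟩
    refine ⟨fun α => (h1 α).add (h1' α), h2.add h2', ?_⟩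
    rw [average_eq] at h3 h3' ⊢
    have : ∫ p, ((v + w) idx0) p ∂(cellMeasure k₀)
        = ∫ p, (v idx0) p ∂(cellMeasure k₀) + ∫ p, (w idx0) p ∂(cellMeasure k₀) := by
      simpa using integral_add_mul k₀ (v idx0) (w idx0) (continuous_const (y := (1 : ℝ)))
    rw [this, smul_add, h3, h3', add_zero]
  zero_mem' := by
    have h0 : ((0 : L2per k₀) : ℝ × ℝ → ℝ) =ᵐ[cellMeasure k₀] 0 := Lp.coeFn_zero _ _ _
    have hi : ∀ u : ℝ × ℝ → ℝ, ∫ p, (0 : L2per k₀) p * u p ∂(cellMeasure k₀) = 0 := fun u => by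
      rw [← zero_smul ℝ (0 : L2per k₀), integral_smul_mul, zero_mul]
    refine ⟨fun α φ _ _ => ?_, fun S hS => ?_, ?_⟩
    · rw [PiLp.zero_apply, PiLp.zero_apply, hi, hi, mul_zero]
    · have h' := (measurePreserving_of_mem_squareGroup k₀ hS).quasiMeasurePreserving.ae h0
      filter_upwards [h0, h'] with p h1 h2
      rw [PiLp.zero_apply, h1, h2, Pi.zero_apply, Pi.zero_apply]
    · have := hi 1
      simp only [Pi.one_apply, mul_one] at this
      rw [average_eq, PiLp.zero_apply, this, smul_zero]
  smul_mem' := by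
    rintro c v ⟨h1, h2, h3⟩
    refine ⟨fun α => (h1 α).smul c, h2.smul c, ?_⟩
    rw [average_eq] at h3 ⊢
    have : ∫ p, ((c • v) idx0) p ∂(cellMeasure k₀) = c * ∫ p, (v idx0) p ∂(cellMeasure k₀) := by
      simpa using integral_smul_mul k₀ c (v idx0) 1
    rw [this, ← smul_eq_mul, smul_comm, h3, smul_zero]

/-- The function underlying an element of `𝒳`. -/
def fn {k₀ : ℝ} (v : X k₀) : L2per k₀ := (v : JetSpace k₀) idx0

/-- The (weak) Laplacian of an element of `𝒳`. -/
def lap {k₀ : ℝ} (v : X k₀) : L2per k₀ := (v : JetSpace k₀) idxXX + (v : JetSpace k₀) idxYY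

/-- The set `𝒰 = {v ∈ 𝒳 : v > -1}`, where the pointwise inequality refers to the continuous
periodic representative of `v ∈ H²_per(□)`. -/
def U (k₀ : ℝ) : Set (X k₀) :=
  {v | ∃ u : ℝ × ℝ → ℝ, Continuous u ∧ SquarePeriodic k₀ u ∧
    u =ᵐ[cellMeasure k₀] fn v ∧ ∀ p, -1 < u p}

lemma zero_mem_U (k₀ : ℝ) : (0 : X k₀) ∈ U k₀ := by
  refine ⟨fun _ => 0, continuous_const, fun _ => ⟨rfl, rfl⟩, ?_, fun _ => by norm_num⟩
  have h0 : ((0 : L2per k₀) : ℝ × ℝ → ℝ) =ᵐ[cellMeasure k₀] 0 := Lp.coeFn_zero _ _ _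
  exact h0.symm

/-- The trivial solution as an element of `𝒰`. -/
def zeroU (k₀ : ℝ) : U k₀ := ⟨0, zero_mem_U k₀⟩

/-! ### The bifurcation function -/

/-- The scalar nonlinearity `1 / (2 + v) + log ((1 + v) / (2 + v))`. -/
def nonlin (y : ℝ) : ℝ := 1 / (2 + y) + Real.log ((1 + y) / (2 + y))

lemma memLp_nonlin {k₀ : ℝ} (v : U k₀) :
    MemLp (fun p => nonlin (fn (v : X k₀) p)) 2 (cellMeasure k₀) := by
  obtain ⟨u, hu, -, huv, hpos⟩ := v.2
  have hc : Continuous fun p => nonlin (u p) := by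
    have h2 : ∀ p, 2 + u p ≠ 0 := fun p => by linarith [hpos p]
    have h1 : ∀ p, (1 + u p) / (2 + u p) ≠ 0 := fun p =>
      div_ne_zero (by linarith [hpos p]) (h2 p)
    unfold nonlin
    exact (continuous_const.div (continuous_const.add hu) h2).add
      (((continuous_const.add hu).div (continuous_const.add hu) h2).log h1)
  refine (memLp_of_continuous k₀ hc).ae_eq ?_
  filter_upwards [huv] with p hp
  rw [hp]

/-- `K(v)`, the mean of the nonlinearity over the cell. -/
def K {k₀ : ℝ} (v : U k₀) : ℝ := ⨍ p, nonlin (fn (v : X k₀) p) ∂(cellMeasure k₀)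

/-- The bifurcation function
`F(v, M) = Δv - g v + M (1 / (2 + v) + log ((1 + v) / (2 + v))) - M K(v)`. -/
def F (g : ℝ) {k₀ : ℝ} (v : U k₀) (M : ℝ) : L2per k₀ :=
  lap (v : X k₀) - g • fn (v : X k₀) + M • (memLp_nonlin v).toLp
    - (memLp_const (M * K v)).toLp

/-- The critical Marangoni number `M*(k₀) = 4 g + 4 k₀²`. -/
def Mstar (g k₀ : ℝ) : ℝ := 4 * g + 4 * k₀ ^ 2

/-! ### The kernel element -/

/-- The function `e^{i k₀ x} + e^{-i k₀ x} + e^{i k₀ y} + e^{-i k₀ y}` in real form. -/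
def xiFun (k₀ : ℝ) (p : ℝ × ℝ) : ℝ := 2 * Real.cos (k₀ * p.1) + 2 * Real.cos (k₀ * p.2)

lemma xiFun_eq_exp (k₀ : ℝ) (p : ℝ × ℝ) : (xiFun k₀ p : ℂ) =
    Complex.exp (Complex.I * k₀ * p.1) + Complex.exp (-(Complex.I * k₀ * p.1))
      + Complex.exp (Complex.I * k₀ * p.2) + Complex.exp (-(Complex.I * k₀ * p.2)) := by
  simp only [xiFun, Complex.ofReal_add, Complex.ofReal_mul, Complex.ofReal_cos,
    Complex.ofReal_ofNat, Complex.two_cos]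
  ring_nf

lemma SquarePeriodic.pderivX {k₀ : ℝ} {u : ℝ × ℝ → ℝ} (h : SquarePeriodic k₀ u) :
    SquarePeriodic k₀ (pderivX u) := by
  intro p
  constructor
  · have e : (fun t => u (t + 2 * Real.pi / k₀, p.2)) = fun t => u (t, p.2) :=
      funext fun t => (h (t, p.2)).1
    have := deriv_comp_add_const (fun t => u (t, p.2)) (2 * Real.pi / k₀) p.1
    rw [e] at this
    exact this.symm
  · have e : (fun t => u (t, p.2 + 2 * Real.pi / k₀)) = fun t => u (t, p.2) :=
      funext fun t => (h (t, p.2)).2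
    simp only [ThinFilm.pderivX, e]

lemma SquarePeriodic.pderivY {k₀ : ℝ} {u : ℝ × ℝ → ℝ} (h : SquarePeriodic k₀ u) :
    SquarePeriodic k₀ (pderivY u) := by
  intro p
  constructor
  · have e : (fun t => u (p.1 + 2 * Real.pi / k₀, t)) = fun t => u (p.1, t) :=
      funext fun t => (h (p.1, t)).1
    simp only [ThinFilm.pderivY, e]
  · have e : (fun t => u (p.1, t + 2 * Real.pi / k₀)) = fun t => u (p.1, t) :=
      funext fun t => (h (p.1, t)).2
    have := deriv_comp_add_const (fun t => u (p.1, t)) (2 * Real.pi / k₀) p.2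
    rw [e] at this
    exact this.symm

lemma SquarePeriodic.mul {k₀ : ℝ} {u w : ℝ × ℝ → ℝ} (hu : SquarePeriodic k₀ u)
    (hw : SquarePeriodic k₀ w) : SquarePeriodic k₀ (fun p => u p * w p) :=
  fun p => ⟨by simp only [(hu p).1, (hw p).1], by simp only [(hu p).2, (hw p).2]⟩

lemma integral_Ioo_deriv_eq_zero {k₀ : ℝ} (hk : 0 < k₀) {f : ℝ → ℝ}
    (hf : ContDiff ℝ (⊤ : ℕ∞) f) (hp : ∀ t, f (t + 2 * Real.pi / k₀) = f t) :
    ∫ t in Ioo (-(Real.pi / k₀)) (Real.pi / k₀), deriv f t = 0 := by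
  have hle : -(Real.pi / k₀) ≤ Real.pi / k₀ := by
    have : 0 < Real.pi / k₀ := by positivity
    linarith
  rw [← integral_Ioc_eq_integral_Ioo, ← intervalIntegral.integral_of_le hle,
    intervalIntegral.integral_deriv_eq_sub (fun x _ => hf.differentiable (by simp) x)
      ((hf.continuous_deriv (by simp)).intervalIntegrable _ _)]
  have := hp (-(Real.pi / k₀))
  rw [show -(Real.pi / k₀) + 2 * Real.pi / k₀ = Real.pi / k₀ by ring] at this
  rw [this, sub_self]

lemma integrable_continuous (k₀ : ℝ) {u : ℝ × ℝ → ℝ} (hu : Continuous u) :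
    Integrable u (cellMeasure k₀) :=
  (memLp_of_continuous k₀ hu).integrable (by norm_num)

lemma integral_pderivY_eq_zero {k₀ : ℝ} (hk : 0 < k₀) {u : ℝ × ℝ → ℝ}
    (hu : ContDiff ℝ (⊤ : ℕ∞) u) (hp : SquarePeriodic k₀ u) :
    ∫ p, pderivY u p ∂(cellMeasure k₀) = 0 := by
  have hi : IntegrableOn (pderivY u) (cell k₀) volume :=
    integrable_continuous k₀ (contDiff_pderivY hu).continuous
  rw [cellMeasure, cell, Measure.volume_eq_prod, setIntegral_prod _ hi]
  have : ∀ x, ∫ y in Ioo (-(Real.pi / k₀)) (Real.pi / k₀), pderivY u (x, y) = 0 := fun x =>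
    integral_Ioo_deriv_eq_zero hk (hu.comp (contDiff_const.prodMk contDiff_id))
      (fun t => (hp (x, t)).2)
  simp only [this, integral_zero]

lemma integral_pderivX_eq_zero {k₀ : ℝ} (hk : 0 < k₀) {u : ℝ × ℝ → ℝ}
    (hu : ContDiff ℝ (⊤ : ℕ∞) u) (hp : SquarePeriodic k₀ u) :
    ∫ p, pderivX u p ∂(cellMeasure k₀) = 0 := by
  have hi : Integrable (pderivX u) (cellMeasure k₀) :=
    integrable_continuous k₀ (contDiff_pderivX hu).continuous
  rw [cellMeasure, cell, Measure.volume_eq_prod, ← Measure.prod_restrict] at hi ⊢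
  rw [integral_prod_symm _ hi]
  have : ∀ y, ∫ x in Ioo (-(Real.pi / k₀)) (Real.pi / k₀), pderivX u (x, y) = 0 := fun y =>
    integral_Ioo_deriv_eq_zero hk (hu.comp (contDiff_id.prodMk contDiff_const))
      (fun t => (hp (t, y)).1)
  simp only [this, integral_zero]

lemma integral_mul_pderivX {k₀ : ℝ} (hk : 0 < k₀) {u φ : ℝ × ℝ → ℝ}
    (hu : ContDiff ℝ (⊤ : ℕ∞) u) (hup : SquarePeriodic k₀ u)
    (hφ : ContDiff ℝ (⊤ : ℕ∞) φ) (hφp : SquarePeriodic k₀ φ) :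
    ∫ p, u p * pderivX φ p ∂(cellMeasure k₀) = -∫ p, pderivX u p * φ p ∂(cellMeasure k₀) := by
  have h := integral_pderivX_eq_zero hk (hu.mul hφ) (hup.mul hφp)
  have e : pderivX (fun p => u p * φ p) = fun p => pderivX u p * φ p + u p * pderivX φ p := by
    funext p
    have h1 : DifferentiableAt ℝ (fun t => u (t, p.2)) p.1 :=
      (hu.comp (contDiff_id.prodMk contDiff_const)).differentiable (by simp) p.1
    have h2 : DifferentiableAt ℝ (fun t => φ (t, p.2)) p.1 :=
      (hφ.comp (contDiff_id.prodMk contDiff_const)).differentiable (by simp) p.1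
    exact deriv_fun_mul h1 h2
  have h1 : Integrable (fun p => pderivX u p * φ p) (cellMeasure k₀) :=
    integrable_continuous k₀ ((contDiff_pderivX hu).continuous.mul hφ.continuous)
  have h2 : Integrable (fun p => u p * pderivX φ p) (cellMeasure k₀) :=
    integrable_continuous k₀ (hu.continuous.mul (contDiff_pderivX hφ).continuous)
  rw [e, integral_add h1 h2] at h
  linarith

lemma integral_mul_pderivY {k₀ : ℝ} (hk : 0 < k₀) {u φ : ℝ × ℝ → ℝ}
    (hu : ContDiff ℝ (⊤ : ℕ∞) u) (hup : SquarePeriodic k₀ u)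
    (hφ : ContDiff ℝ (⊤ : ℕ∞) φ) (hφp : SquarePeriodic k₀ φ) :
    ∫ p, u p * pderivY φ p ∂(cellMeasure k₀) = -∫ p, pderivY u p * φ p ∂(cellMeasure k₀) := by
  have h := integral_pderivY_eq_zero hk (hu.mul hφ) (hup.mul hφp)
  have e : pderivY (fun p => u p * φ p) = fun p => pderivY u p * φ p + u p * pderivY φ p := by
    funext p
    have h1 : DifferentiableAt ℝ (fun t => u (p.1, t)) p.2 :=
      (hu.comp (contDiff_const.prodMk contDiff_id)).differentiable (by simp) p.2
    have h2 : DifferentiableAt ℝ (fun t => φ (p.1, t)) p.2 :=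
      (hφ.comp (contDiff_const.prodMk contDiff_id)).differentiable (by simp) p.2
    exact deriv_fun_mul h1 h2
  have h1 : Integrable (fun p => pderivY u p * φ p) (cellMeasure k₀) :=
    integrable_continuous k₀ ((contDiff_pderivY hu).continuous.mul hφ.continuous)
  have h2 : Integrable (fun p => u p * pderivY φ p) (cellMeasure k₀) :=
    integrable_continuous k₀ (hu.continuous.mul (contDiff_pderivY hφ).continuous)
  rw [e, integral_add h1 h2] at h
  linarith

lemma integral_mul_iterate_pderivX {k₀ : ℝ} (hk : 0 < k₀) {φ : ℝ × ℝ → ℝ}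
    (hφ : ContDiff ℝ (⊤ : ℕ∞) φ) (hφp : SquarePeriodic k₀ φ) (n : ℕ) :
    ContDiff ℝ (⊤ : ℕ∞) (pderivX^[n] φ) ∧ SquarePeriodic k₀ (pderivX^[n] φ) ∧
    ∀ u : ℝ × ℝ → ℝ, ContDiff ℝ (⊤ : ℕ∞) u → SquarePeriodic k₀ u →
      ∫ p, u p * pderivX^[n] φ p ∂(cellMeasure k₀)
        = (-1) ^ n * ∫ p, pderivX^[n] u p * φ p ∂(cellMeasure k₀) := by
  induction n with
  | zero => exact ⟨hφ, hφp, fun u _ _ => by simp⟩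
  | succ n ih =>
    rw [Function.iterate_succ_apply']
    refine ⟨contDiff_pderivX ih.1, ih.2.1.pderivX, fun u hu hup => ?_⟩
    rw [integral_mul_pderivX hk hu hup ih.1 ih.2.1,
      ih.2.2 _ (contDiff_pderivX hu) hup.pderivX, ← Function.iterate_succ_apply]
    ring

lemma integral_mul_iterate_pderivY {k₀ : ℝ} (hk : 0 < k₀) {φ : ℝ × ℝ → ℝ}
    (hφ : ContDiff ℝ (⊤ : ℕ∞) φ) (hφp : SquarePeriodic k₀ φ) (n : ℕ) :
    ContDiff ℝ (⊤ : ℕ∞) (pderivY^[n] φ) ∧ SquarePeriodic k₀ (pderivY^[n] φ) ∧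
    ∀ u : ℝ × ℝ → ℝ, ContDiff ℝ (⊤ : ℕ∞) u → SquarePeriodic k₀ u →
      ∫ p, u p * pderivY^[n] φ p ∂(cellMeasure k₀)
        = (-1) ^ n * ∫ p, pderivY^[n] u p * φ p ∂(cellMeasure k₀) := by
  induction n with
  | zero => exact ⟨hφ, hφp, fun u _ _ => by simp⟩
  | succ n ih =>
    rw [Function.iterate_succ_apply']
    refine ⟨contDiff_pderivY ih.1, ih.2.1.pderivY, fun u hu hup => ?_⟩
    rw [integral_mul_pderivY hk hu hup ih.1 ih.2.1,
      ih.2.2 _ (contDiff_pderivY hu) hup.pderivY, ← Function.iterate_succ_apply]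
    ring

lemma contDiff_xiFun (k₀ : ℝ) : ContDiff ℝ (⊤ : ℕ∞) (xiFun k₀) := by
  unfold xiFun
  exact (contDiff_const.mul (contDiff_const.mul contDiff_fst).cos).add
    (contDiff_const.mul (contDiff_const.mul contDiff_snd).cos)

lemma periodic_xiFun {k₀ : ℝ} (hk : 0 < k₀) : SquarePeriodic k₀ (xiFun k₀) := by
  have h : ∀ t : ℝ, k₀ * (t + 2 * Real.pi / k₀) = k₀ * t + 2 * Real.pi := fun t => by
    field_simp
  intro p
  constructor <;> simp only [xiFun, h, Real.cos_add_two_pi]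

/-- The derivative `∂_y^{α₂} ∂_x^{α₁}` of the kernel function. -/
def xiDeriv (k₀ : ℝ) (α : MultiIdx) : ℝ × ℝ → ℝ :=
  pderivY^[(α.1.2 : ℕ)] (pderivX^[(α.1.1 : ℕ)] (xiFun k₀))

lemma contDiff_xiDeriv {k₀ : ℝ} (hk : 0 < k₀) (α : MultiIdx) :
    ContDiff ℝ (⊤ : ℕ∞) (xiDeriv k₀ α) := by
  have h := integral_mul_iterate_pderivX hk (contDiff_xiFun k₀) (periodic_xiFun hk) α.1.1
  exact (integral_mul_iterate_pderivY hk h.1 h.2.1 α.1.2).1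

/-- The function `xiFun` together with its derivatives up to order two. -/
def xiJet {k₀ : ℝ} (hk : 0 < k₀) : JetSpace k₀ :=
  WithLp.toLp 2 fun α => (memLp_of_continuous k₀ (contDiff_xiDeriv hk α).continuous).toLp

lemma xiJet_idx0 {k₀ : ℝ} (hk : 0 < k₀) :
    (xiJet hk idx0 : ℝ × ℝ → ℝ) =ᵐ[cellMeasure k₀] xiFun k₀ :=
  MemLp.coeFn_toLp (memLp_of_continuous k₀ (contDiff_xiDeriv hk idx0).continuous)

lemma xiFun_squareGroup (k₀ : ℝ) {S : Equiv.Perm (ℝ × ℝ)} (hS : S ∈ squareGroup) :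
    ∀ p, xiFun k₀ (S p) = xiFun k₀ p := by
  induction hS using Subgroup.closure_induction with
  | mem x hx =>
    intro p
    rcases hx with rfl | rfl
    · simp [xiFun, quarterTurn, add_comm]
    · simp [xiFun, axisReflection]
  | one => intro p; rfl
  | mul x y _ _ hx hy => intro p; rw [Equiv.Perm.mul_apply, hx, hy]
  | inv x _ hx => intro p; rw [← hx (x⁻¹ p)]; simp

lemma integral_xiFun {k₀ : ℝ} (hk : 0 < k₀) : ∫ p, xiFun k₀ p ∂(cellMeasure k₀) = 0 := by
  set s : ℝ × ℝ → ℝ := fun p => 2 / k₀ * Real.sin (k₀ * p.1) + 2 / k₀ * Real.sin (k₀ * p.2)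
    with hs
  have hsc : ContDiff ℝ (⊤ : ℕ∞) s :=
    (contDiff_const.mul (contDiff_const.mul contDiff_fst).sin).add
      (contDiff_const.mul (contDiff_const.mul contDiff_snd).sin)
  have hsp : SquarePeriodic k₀ s := by
    have h : ∀ t : ℝ, k₀ * (t + 2 * Real.pi / k₀) = k₀ * t + 2 * Real.pi := fun t => by
      field_simp
    intro p
    constructor <;> simp only [hs, h, Real.sin_add_two_pi]
  have hd : ∀ t : ℝ, HasDerivAt (fun t => 2 / k₀ * Real.sin (k₀ * t)) (2 * Real.cos (k₀ * t)) t := by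
    intro t
    have h := (((hasDerivAt_id' t).const_mul k₀).sin).const_mul (2 / k₀)
    have e : 2 / k₀ * (Real.cos (k₀ * t) * (k₀ * 1)) = 2 * Real.cos (k₀ * t) := by
      field_simp
    rwa [e] at h
  have e : xiFun k₀ = fun p => pderivX s p + pderivY s p := by
    funext p
    have h1 : pderivX s p = 2 * Real.cos (k₀ * p.1) :=
      ((hd p.1).add_const (2 / k₀ * Real.sin (k₀ * p.2))).deriv
    have h2 : pderivY s p = 2 * Real.cos (k₀ * p.2) :=
      ((hd p.2).const_add (2 / k₀ * Real.sin (k₀ * p.1))).deriv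
    rw [h1, h2, xiFun]
  rw [e, integral_add (integrable_continuous k₀ (contDiff_pderivX hsc).continuous)
    (integrable_continuous k₀ (contDiff_pderivY hsc).continuous),
    integral_pderivX_eq_zero hk hsc hsp, integral_pderivY_eq_zero hk hsc hsp, add_zero]

lemma xiJet_mem {k₀ : ℝ} (hk : 0 < k₀) : xiJet hk ∈ X k₀ := by
  have h0 := xiJet_idx0 hk
  refine ⟨fun α φ hφ hφp => ?_, fun S hS => ?_, ?_⟩
  · have hα : (xiJet hk α : ℝ × ℝ → ℝ) =ᵐ[cellMeasure k₀] xiDeriv k₀ α :=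
      MemLp.coeFn_toLp (memLp_of_continuous k₀ (contDiff_xiDeriv hk α).continuous)
    have e1 : ∫ p, (xiJet hk idx0) p * classicalDeriv α φ p ∂(cellMeasure k₀)
        = ∫ p, xiFun k₀ p * classicalDeriv α φ p ∂(cellMeasure k₀) :=
      integral_congr_ae (by filter_upwards [h0] with p hp; rw [hp])
    have e2 : ∫ p, (xiJet hk α) p * φ p ∂(cellMeasure k₀)
        = ∫ p, xiDeriv k₀ α p * φ p ∂(cellMeasure k₀) :=
      integral_congr_ae (by filter_upwards [hα] with p hp; rw [hp])
    have hY := integral_mul_iterate_pderivY hk hφ hφp α.1.2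
    have hX := integral_mul_iterate_pderivX hk hY.1 hY.2.1 α.1.1
    have hx := integral_mul_iterate_pderivX hk (contDiff_xiFun k₀) (periodic_xiFun hk) α.1.1
    rw [e1, e2, classicalDeriv, hX.2.2 _ (contDiff_xiFun k₀) (periodic_xiFun hk),
      hY.2.2 _ hx.1 hx.2.1, xiDeriv, pow_add, mul_assoc]
  · have h' := (measurePreserving_of_mem_squareGroup k₀ hS).quasiMeasurePreserving.ae h0
    filter_upwards [h0, h'] with p h1 h2
    rw [h1, h2, xiFun_squareGroup k₀ hS]
  · rw [average_eq, integral_congr_ae h0, integral_xiFun hk, smul_zero]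

/-- The kernel element `ξ₀ ∈ 𝒳`. -/
def xi {k₀ : ℝ} (hk : 0 < k₀) : X k₀ := ⟨xiJet hk, xiJet_mem hk⟩

/-- The normalised kernel element `ξ₀ / ‖ξ₀‖_𝒳`. -/
def xiHat {k₀ : ℝ} (hk : 0 < k₀) : X k₀ := ‖xi hk‖⁻¹ • xi hk

end ThinFilm

end

/-! The proof is a Lyapunov–Schmidt reduction in explicit Fourier coordinates. Near `0` the
nonlinearity is `c₀ + v/4 - v²/4 + (11/48) v³ + v⁴ r(v)`, and at `M* = 4g + 4k²` the linear part of
`F` is `Δ + k²`. On symmetric functions of mean zero its kernel is spanned by `ξ₀`, twice the mode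
`(1,0)`; on every mode `cos(kmx)cos(kny) + cos(knx)cos(kmy)` with `m² + n² ≥ 2` it is invertible.

With the ansatz `v = t ξ₀ + t² S z`, `M = M* + t² m`, where `S` inverts `Δ + k²` on those modes, the
range part of the equation is divisible by `t²` and the kernel part by `t³`, because `ξ₀²` is
orthogonal to `ξ₀`. The divided system is `C¹` near `t = 0`, and at `t = 0` it is affine and
triangular in `(z, m)`. The implicit function theorem thus yields `C¹` functions `z(t)`, `m(t)`
(`exists_branch`). The value `m(0)` combines the cubic term with the quadratic response of the modes
`(2,0)` and `(1,1)`; it is negative, so the pitchfork is subcritical.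

Two devices keep the analysis elementary. Square-summability of the inverse eigenvalues makes `S`
map into bounded continuous functions, a Banach algebra in which the remainder is a convergent power
series (`exists_solutionOperator`, `nonlin_apply`). Completeness of the modes is not needed:
products of modes are combinations of modes, so `F` along the branch stays in their closed span, and
it vanishes there once its product with every mode does (`F_branch_eq_zero`). Passing from `t` to `s
= t ‖ξ₀‖` gives the stated normalisation. -/

namespace ThinFilm

/-! ### Abstract Lyapunov–Schmidt reduction in a Banach algebra. -/

section Branch

variable {H 𝒜 : Type*} [NormedAddCommGroup H] [NormedSpace ℝ H]
  [NormedCommRing 𝒜] [NormedAlgebra ℝ 𝒜]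

/-- The rescaled equation on the complement of the kernel. -/
noncomputable def blowUpRange (S : H →L[ℝ] 𝒜) (B : 𝒜 →L[ℝ] H) (ξ : 𝒜) (r : 𝒜 → 𝒜) (M₀ c₂ c₃ : ℝ)
    (q : ℝ × H × ℝ) : H :=
  q.2.1 + (q.2.2 * q.1 ^ 2 / 4) • B (S q.2.1) + (M₀ + q.1 ^ 2 * q.2.2) •
    B (c₂ • (ξ + q.1 • S q.2.1) ^ 2 + (q.1 * c₃) • (ξ + q.1 • S q.2.1) ^ 3
      + q.1 ^ 2 • ((ξ + q.1 • S q.2.1) ^ 4 * r (q.1 • (ξ + q.1 • S q.2.1))))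

/-- The rescaled equation in the direction of the kernel. -/
noncomputable def blowUpKernel (S : H →L[ℝ] 𝒜) (ℓ : 𝒜 →L[ℝ] ℝ) (ξ : 𝒜) (r : 𝒜 → 𝒜) (M₀ c₂ c₃ : ℝ)
    (q : ℝ × H × ℝ) : ℝ :=
  q.2.2 / 4 * ℓ ξ + (M₀ + q.1 ^ 2 * q.2.2) *
    (2 * c₂ * ℓ (ξ * S q.2.1) + c₂ * q.1 * ℓ (S q.2.1 ^ 2)
      + c₃ * ℓ ((ξ + q.1 • S q.2.1) ^ 3)
      + q.1 * ℓ ((ξ + q.1 • S q.2.1) ^ 4 * r (q.1 • (ξ + q.1 • S q.2.1))))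

/-- The argument of `r` carries a factor `t`, so at `t = 0` it is `0` whatever `z` is; smoothness of
`r` at that single point suffices. -/
lemma contDiffAt_blowUp (S : H →L[ℝ] 𝒜) (B : 𝒜 →L[ℝ] H) (ℓ : 𝒜 →L[ℝ] ℝ) (ξ : 𝒜) {r : 𝒜 → 𝒜}
    (hr : ContDiffAt ℝ 1 r 0) (M₀ c₂ c₃ : ℝ) (p : H × ℝ) :
    ContDiffAt ℝ 1 (fun q => (blowUpRange S B ξ r M₀ c₂ c₃ q, blowUpKernel S ℓ ξ r M₀ c₂ c₃ q))
      (0, p) := by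
  have h1 : ContDiff ℝ 1 fun q : ℝ × H × ℝ => S q.2.1 := by fun_prop
  have h2 : ContDiff ℝ 1 fun q : ℝ × H × ℝ => ξ + q.1 • S q.2.1 := by fun_prop
  have h3 : ContDiffAt ℝ 1 (fun q : ℝ × H × ℝ => r (q.1 • (ξ + q.1 • S q.2.1))) (0, p) := by
    refine ContDiffAt.comp (g := r) (0, p) ?_ (by fun_prop)
    simpa using hr
  have h4 : ContDiffAt ℝ 1 (fun q : ℝ × H × ℝ =>
      (ξ + q.1 • S q.2.1) ^ 4 * r (q.1 • (ξ + q.1 • S q.2.1))) (0, p) :=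
    (h2.contDiffAt.pow 4).mul h3
  have h5 := h2.pow 2
  have h6 := h2.pow 3
  unfold blowUpRange blowUpKernel
  refine ContDiffAt.prodMk ?_ ?_
  · fun_prop
  · have h7 : ContDiff ℝ 1 fun q : ℝ × H × ℝ => ξ * S q.2.1 := contDiff_const.mul h1
    have h8 := h1.pow 2
    fun_prop

/-- The rescaled equations are multiplied back by `t²` and `t³`, so `t = 0` needs no separate case.
`B ξ = 0` and `ℓ ∘ S = 0` decouple the linear terms; `ℓ(ξ²) = 0` removes the only contribution of
order `t²` to the kernel equation. -/
lemma of_blowUp_eq_zero {S : H →L[ℝ] 𝒜} {B : 𝒜 →L[ℝ] H} {ℓ : 𝒜 →L[ℝ] ℝ}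
    {ξ : 𝒜} {r : 𝒜 → 𝒜} {M₀ c₂ c₃ : ℝ}
    (hB : B ξ = 0) (hℓS : ∀ z, ℓ (S z) = 0) (hξ2 : ℓ (ξ ^ 2) = 0) {t m : ℝ} {z : H}
    (h1 : blowUpRange S B ξ r M₀ c₂ c₃ (t, z, m) = 0)
    (h2 : blowUpKernel S ℓ ξ r M₀ c₂ c₃ (t, z, m) = 0)
    {u N : 𝒜} (hu : u = t • ξ + t ^ 2 • S z) (hN : N = c₂ • u ^ 2 + c₃ • u ^ 3 + u ^ 4 * r u) :
    t ^ 2 • z + (t ^ 2 * m / 4) • B u + (M₀ + t ^ 2 * m) • B N = 0 ∧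
      t ^ 2 * m / 4 * ℓ u + (M₀ + t ^ 2 * m) * ℓ N = 0 := by
  simp only [blowUpRange, blowUpKernel] at h1 h2
  have hu' : u = t • (ξ + t • S z) := by rw [hu, smul_add, smul_smul, sq]
  set û := ξ + t • S z with hû
  have hNe : N = t ^ 2 • (c₂ • û ^ 2 + (t * c₃) • û ^ 3 + t ^ 2 • (û ^ 4 * r (t • û))) := by
    rw [hN, hu', smul_pow, smul_pow, smul_pow, smul_mul_assoc]
    simp only [smul_add, smul_smul]
    ring_nf
  have hBu : B u = t ^ 2 • B (S z) := by
    rw [hu, map_add, map_smul, map_smul, hB, smul_zero, zero_add]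
  have hℓu : ℓ u = t * ℓ ξ := by
    rw [hu, map_add, map_smul, map_smul, hℓS, smul_zero, add_zero, smul_eq_mul]
  constructor
  · rw [hBu, hNe, map_smul]
    have := congrArg (fun x => t ^ 2 • x) h1
    simp only [smul_zero, smul_add] at this
    rw [← this, smul_smul, smul_smul, smul_smul, smul_smul]
    ring_nf
  · have hsq : û ^ 2 = ξ ^ 2 + (2 * t) • (ξ * S z) + t ^ 2 • S z ^ 2 := by
      rw [hû]
      simp only [Algebra.smul_def, map_mul, map_pow, map_ofNat]
      ring
    have hl2 : ℓ (û ^ 2) = 2 * t * ℓ (ξ * S z) + t ^ 2 * ℓ (S z ^ 2) := by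
      rw [hsq, map_add, map_add, map_smul, map_smul, hξ2, zero_add, smul_eq_mul, smul_eq_mul]
    rw [hℓu, hNe]
    simp only [map_add, map_smul, smul_eq_mul, hl2]
    linear_combination t ^ 3 * h2

/-- Lyapunov–Schmidt reduction with a one-dimensional kernel spanned by `ξ`: the solutions are
`t ξ + t² S (z t)`. -/
theorem exists_branch [CompleteSpace H] (S : H →L[ℝ] 𝒜) (B : 𝒜 →L[ℝ] H) (ℓ : 𝒜 →L[ℝ] ℝ)
    (ξ : 𝒜) {r : 𝒜 → 𝒜} (hr : ContDiffAt ℝ 1 r 0) (M₀ c₂ c₃ : ℝ)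
    (hB : B ξ = 0) (hℓS : ∀ z, ℓ (S z) = 0) (hξ2 : ℓ (ξ ^ 2) = 0) (hξ : ℓ ξ ≠ 0) :
    ∃ (z : ℝ → H) (m : ℝ → ℝ), ContDiffAt ℝ 1 z 0 ∧ ContDiffAt ℝ 1 m 0 ∧
      m 0 / 4 * ℓ ξ = - M₀ * (c₃ * ℓ (ξ ^ 3) - 2 * M₀ * c₂ ^ 2 * ℓ (ξ * S (B (ξ ^ 2)))) ∧
      ∀ᶠ t in 𝓝 0, ∀ u, u = t • ξ + t ^ 2 • S (z t) →
      ∀ N, N = c₂ • u ^ 2 + c₃ • u ^ 3 + u ^ 4 * r u →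
        t ^ 2 • z t + (t ^ 2 * m t / 4) • B u + (M₀ + t ^ 2 * m t) • B N = 0 ∧
        t ^ 2 * m t / 4 * ℓ u + (M₀ + t ^ 2 * m t) * ℓ N = 0 := by
  -- At `t = 0` the range equation determines `z₀` alone, and then the kernel equation determines
  -- `m₀`.
  set z₀ : H := -(M₀ * c₂) • B (ξ ^ 2) with hz₀
  set m₀ : ℝ := 4 / ℓ ξ * (-M₀ * (2 * c₂ * ℓ (ξ * S z₀) + c₃ * ℓ (ξ ^ 3))) with hm₀
  set G : ℝ × H × ℝ → H × ℝ :=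
    fun q => (blowUpRange S B ξ r M₀ c₂ c₃ q, blowUpKernel S ℓ ξ r M₀ c₂ c₃ q) with hG
  have hGc : ContDiffAt ℝ 1 G (0, (z₀, m₀)) := contDiffAt_blowUp S B ℓ ξ hr M₀ c₂ c₃ (z₀, m₀)
  have hG0 : ∀ p : H × ℝ, G (0, p) = (p.1 + (M₀ * c₂) • B (ξ ^ 2),
      p.2 / 4 * ℓ ξ + M₀ * (2 * c₂ * ℓ (ξ * S p.1) + c₃ * ℓ (ξ ^ 3))) := by
    intro p
    simp [hG, blowUpRange, blowUpKernel, smul_smul]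
  have hGz : G (0, (z₀, m₀)) = 0 := by
    rw [hG0]
    ext
    · simp [hz₀]
    · simp only [hm₀, Prod.snd_zero]
      field_simp
      ring
  set Λ : H →L[ℝ] ℝ := (2 * c₂ * M₀) • ℓ.comp ((ContinuousLinearMap.mul ℝ 𝒜 ξ).comp S) with hΛ
  -- `G (0, ·)` is affine, so its derivative is its linear part: lower triangular with diagonal `id`
  -- and `ℓ ξ / 4`, hence invertible because `ℓ ξ ≠ 0`.
  have hfd : fderiv ℝ G (0, (z₀, m₀)) ∘L .inr ℝ ℝ (H × ℝ) =
      (ContinuousLinearMap.fst ℝ H ℝ).prod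
        (Λ.comp (ContinuousLinearMap.fst ℝ H ℝ) + (ℓ ξ / 4) • ContinuousLinearMap.snd ℝ H ℝ) := by
    have hd := (hGc.differentiableAt (by simp)).hasFDerivAt
    have hc : HasFDerivAt (fun p : H × ℝ => G (0, p))
        (fderiv ℝ G (0, (z₀, m₀)) ∘L .inr ℝ ℝ (H × ℝ)) (z₀, m₀) :=
      HasFDerivAt.comp (g := G) (z₀, m₀) hd (hasFDerivAt_prodMk_right 0 (z₀, m₀))
    refine hc.unique ?_
    have he : (fun p : H × ℝ => G (0, p)) = fun p =>
        ((ContinuousLinearMap.fst ℝ H ℝ).prod (Λ.comp (ContinuousLinearMap.fst ℝ H ℝ)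
          + (ℓ ξ / 4) • ContinuousLinearMap.snd ℝ H ℝ)) p
          + ((M₀ * c₂) • B (ξ ^ 2), M₀ * c₃ * ℓ (ξ ^ 3)) := by
      funext p
      rw [hG0]
      ext
      · simp
      · simp [hΛ]; ring
    rw [he]
    exact (ContinuousLinearMap.hasFDerivAt _).add_const _
  have hinv : (fderiv ℝ G (0, (z₀, m₀)) ∘L .inr ℝ ℝ (H × ℝ)).IsInvertible := by
    rw [hfd]
    refine ContinuousLinearMap.IsInvertible.of_inverse
      (g := (ContinuousLinearMap.fst ℝ H ℝ).prod ((4 / ℓ ξ) • (ContinuousLinearMap.snd ℝ H ℝ -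
        Λ.comp (ContinuousLinearMap.fst ℝ H ℝ)))) ?_ ?_
    · refine ContinuousLinearMap.ext fun p => Prod.ext rfl ?_
      simp
      field_simp
      ring
    · refine ContinuousLinearMap.ext fun p => Prod.ext rfl ?_
      simp
      field_simp
  obtain ⟨ψ, hψc, hψ0, hψe⟩ : ∃ ψ : ℝ → H × ℝ, ContDiffAt ℝ 1 ψ 0 ∧ ψ 0 = (z₀, m₀) ∧
      ∀ᶠ t in 𝓝 0, G (t, ψ t) = 0 :=
    ⟨_, hGc.contDiffAt_implicitFunction one_ne_zero hinv,
      hGc.implicitFunction_apply_self one_ne_zero hinv,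
      hGz ▸ hGc.eventually_apply_implicitFunction one_ne_zero hinv⟩
  refine ⟨fun t => (ψ t).1, fun t => (ψ t).2, hψc.fst, hψc.snd, ?_, ?_⟩
  · simp only [hψ0, hm₀, hz₀, map_neg, map_smul, neg_smul, mul_neg, mul_smul_comm, smul_eq_mul]
    field_simp
    ring
  · filter_upwards [hψe] with t ht u hu N hN
    obtain ⟨h1, h2⟩ := Prod.ext_iff.1 ht
    exact of_blowUp_eq_zero hB hℓS hξ2 h1 h2 hu hN

end Branch

/-! ### Taylor expansion of the nonlinearity in a Banach algebra. -/

section Nonlinearity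

/-- The Taylor coefficients at `0` of the remainder of order four of `nonlin`. -/
noncomputable def remCoeff (n : ℕ) : ℝ :=
  (-1) ^ n * ((1 / 2) ^ (n + 5) - 1 / ((n : ℝ) + 4) + (1 / 2) ^ (n + 4) / ((n : ℝ) + 4))

lemma abs_remCoeff_le (n : ℕ) : |remCoeff n| ≤ 1 := by
  have h1 : (0 : ℝ) ≤ (1 / 2) ^ (n + 5) := by positivity
  have h2 : ((1 : ℝ) / 2) ^ (n + 5) ≤ 1 / 2 := by
    simpa using pow_le_pow_of_le_one (by norm_num) (by norm_num) (show 1 ≤ n + 5 by omega)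
      (a := (1 / 2 : ℝ))
  have h3 : 0 ≤ 1 / ((n : ℝ) + 4) := by positivity
  have h4 : 1 / ((n : ℝ) + 4) ≤ 1 / 4 := by
    apply one_div_le_one_div_of_le <;> linarith [Nat.cast_nonneg (α := ℝ) n]
  have h5 : (0 : ℝ) ≤ (1 / 2) ^ (n + 4) / ((n : ℝ) + 4) := by positivity
  have h6 : (1 / 2 : ℝ) ^ (n + 4) / ((n : ℝ) + 4) ≤ 1 / ((n : ℝ) + 4) := by
    gcongr
    exact pow_le_one₀ (by norm_num) (by norm_num)
  rw [remCoeff, abs_mul, abs_pow, abs_neg, abs_one, one_pow, one_mul, abs_le]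
  constructor <;> linarith

/-- The series combines `log(1+y)`, `log(2+y) = log 2 + log(1+y/2)` and the geometric series of
`1/(2+y)`, each with its powers up to `y³` split off. -/
lemma hasSum_nonlin {y : ℝ} (hy : |y| < 1) :
    HasSum (fun n => y ^ 4 * (remCoeff n * y ^ n))
      (nonlin y - (1 / 2 - Real.log 2) - y / 4 + y ^ 2 / 4 - 11 / 48 * y ^ 3) := by
  obtain ⟨h1, h2⟩ := abs_lt.1 hy
  have e1 := Real.hasSum_pow_div_log_of_abs_lt_one (x := -y) (by rwa [abs_neg])
  have hy2 : |-y / 2| < 1 := by rw [abs_lt]; constructor <;> linarith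
  have e2 := Real.hasSum_pow_div_log_of_abs_lt_one hy2
  have e3 := (hasSum_geometric_of_abs_lt_one hy2).mul_left (1 / 2)
  -- The logarithmic series start at the first power and the geometric one at the constant, so three
  -- and four terms respectively remove all powers up to `y³`.
  have e1' := (hasSum_nat_add_iff' 3).2 e1
  have e2' := (hasSum_nat_add_iff' 3).2 e2
  have e3' := (hasSum_nat_add_iff' 4).2 e3
  have hs := (e3'.sub e1').add e2'
  have hf : (fun n => y ^ 4 * (remCoeff n * y ^ n)) = fun n : ℕ => 1 / 2 * (-y / 2) ^ (n + 4)
      - (-y) ^ (n + 3 + 1) / (((n + 3 : ℕ) : ℝ) + 1)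
      + (-y / 2) ^ (n + 3 + 1) / (((n + 3 : ℕ) : ℝ) + 1) := by
    funext n
    have : ((-y) ^ (n + 4) : ℝ) = (-1) ^ n * y ^ n * y ^ 4 := by
      rw [neg_pow]; ring
    have h' : ((-y / 2) ^ (n + 4) : ℝ) = (-1) ^ n * y ^ n * y ^ 4 * (1 / 2) ^ (n + 4) := by
      rw [div_eq_mul_one_div, mul_pow, this]
    have hn : ((n + 3 : ℕ) : ℝ) + 1 = (n : ℝ) + 4 := by push_cast; ring
    rw [show n + 3 + 1 = n + 4 by ring, this, h', hn, remCoeff]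
    ring
  have l : nonlin y = 1 / (2 + y) + (Real.log (1 - -y) - (Real.log 2 + Real.log (1 - -y / 2))) := by
    rw [nonlin, Real.log_div (by linarith) (by linarith),
      ← Real.log_mul (by norm_num) (by linarith)]
    ring_nf
  have g : (1 / 2 : ℝ) * (1 - -y / 2)⁻¹ = 1 / (2 + y) := by
    rw [show 1 - -y / 2 = (2 + y) / 2 by ring, inv_div]
    ring
  rw [g] at hs
  rw [hf, l]
  convert hs using 1
  · rfl
  · simp only [Finset.sum_range_succ, Finset.sum_range_zero]
    push_cast
    ring

/-- The remainder of order four of `nonlin`, as a power series in a normed algebra. -/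
noncomputable def remainder {𝒜 : Type*} [NormedCommRing 𝒜] [NormedAlgebra ℝ 𝒜] (u : 𝒜) : 𝒜 :=
  FormalMultilinearSeries.ofScalarsSum remCoeff u

variable {𝒜 : Type*} [NormedCommRing 𝒜] [NormedAlgebra ℝ 𝒜] [NormOneClass 𝒜] [CompleteSpace 𝒜]

lemma hasFPowerSeriesOnBall_remainder :
    HasFPowerSeriesOnBall (remainder (𝒜 := 𝒜)) (FormalMultilinearSeries.ofScalars 𝒜 remCoeff)
      0 1 := by
  have h : 1 ≤ (FormalMultilinearSeries.ofScalars 𝒜 remCoeff).radius := by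
    refine FormalMultilinearSeries.le_radius_of_bound _ 1 fun n => ?_
    rw [FormalMultilinearSeries.ofScalars_norm]
    simpa using abs_remCoeff_le n
  exact ((FormalMultilinearSeries.ofScalars 𝒜 remCoeff).hasFPowerSeriesOnBall
    (zero_lt_one.trans_le h)).mono zero_lt_one h

lemma contDiffAt_remainder : ContDiffAt ℝ 1 (remainder (𝒜 := 𝒜)) 0 :=
  (hasFPowerSeriesOnBall_remainder (𝒜 := 𝒜)).analyticAt.contDiffAt

lemma hasSum_remainder {u : 𝒜} (hu : ‖u‖ < 1) :
    HasSum (fun n => remCoeff n • u ^ n) (remainder u) := by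
  have := (hasFPowerSeriesOnBall_remainder (𝒜 := 𝒜)).hasSum (y := u) (by
    rw [Metric.mem_eball, edist_zero_right, ← ofReal_norm]
    exact ENNReal.ofReal_lt_one.2 hu)
  simpa [FormalMultilinearSeries.ofScalars_apply_eq] using this

/-- The partial sums are polynomials in `u`. This keeps the full nonlinearity inside the closed
algebra generated by the modes. -/
lemma remainder_mem {u : 𝒜} (hu : ‖u‖ < 1) (A : Subalgebra ℝ 𝒜) (hA : IsClosed (A : Set 𝒜))
    (hm : u ∈ A) : remainder u ∈ A :=
  hA.mem_of_tendsto (hasSum_remainder hu) (Eventually.of_forall fun _ =>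
    sum_mem fun _ _ => A.smul_mem (pow_mem hm _) _)

open scoped BoundedContinuousFunction

/-- Evaluation at a point is continuous and multiplicative, so it turns the series in the algebra
into the scalar one. -/
lemma nonlin_apply {E : Type*} [TopologicalSpace E] [Nonempty E] {u : E →ᵇ ℝ}
    (hu : ‖u‖ < 1) (p : E) :
    nonlin (u p) = ((1 / 2 - Real.log 2) • (1 : E →ᵇ ℝ) + (1 / 4 : ℝ) • u
      + ((-1 / 4 : ℝ) • u ^ 2 + (11 / 48 : ℝ) • u ^ 3 + u ^ 4 * remainder u)) p := by
  have hp : |u p| < 1 := (u.norm_coe_le_norm p).trans_lt hu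
  have h1 : HasSum (fun n => remCoeff n * u p ^ n) (remainder u p) :=
    (hasSum_remainder hu).map (BoundedContinuousFunction.evalCLM ℝ p)
      (BoundedContinuousFunction.evalCLM ℝ p).continuous
  have h2 := (hasSum_nonlin hp).unique (h1.mul_left _)
  simp only [BoundedContinuousFunction.coe_add, Pi.add_apply, BoundedContinuousFunction.coe_smul,
    BoundedContinuousFunction.coe_mul, Pi.mul_apply,
    BoundedContinuousFunction.coe_one, BoundedContinuousFunction.coe_pow, Pi.pow_apply,
    Pi.one_apply, smul_eq_mul]
  linarith

end Nonlinearity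

/-! ### Bounded operators on `ℓ²` prescribed on the standard basis. -/

section SequenceSpace

open scoped lp ENNReal

variable {ι : Type*} [DecidableEq ι]

/-- Through this lemma each continuous linear identity needed of the solution operators reduces to a
check on single modes. -/
lemma clm_lp_ext {F : Type*} [NormedAddCommGroup F] [NormedSpace ℝ F]
    {f g : ℓ²(ι, ℝ) →L[ℝ] F}
    (h : ∀ i, f (lp.single 2 i (1 : ℝ)) = g (lp.single 2 i (1 : ℝ))) : f = g := by
  refine lp.ext_continuousLinearMap (by simp) fun i => ?_
  ext
  simpa using h i

lemma exists_clm_of_orthonormal {E : Type*} [NormedAddCommGroup E] [InnerProductSpace ℝ E]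
    [CompleteSpace E] {e : ι → E} (he : Orthonormal ℝ e) :
    ∃ T : ℓ²(ι, ℝ) →ₗᵢ[ℝ] E, ∀ i, T (lp.single 2 i (1 : ℝ)) = e i :=
  ⟨he.orthogonalFamily.linearIsometry, fun i => by simp⟩

lemma exists_diagonal_clm (d : ι → ℝ) {C : ℝ} (hd : ∀ i, |d i| ≤ C) :
    ∃ D : ℓ²(ι, ℝ) →L[ℝ] ℓ²(ι, ℝ),
      ∀ i, D (lp.single 2 i (1 : ℝ)) = d i • lp.single 2 i (1 : ℝ) := by
  have hle : ∀ (a : ℓ²(ι, ℝ)) i, ‖d i * a i‖ ≤ ‖(C • a) i‖ := fun a i => by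
    rw [norm_mul, lp.coeFn_smul, Pi.smul_apply, smul_eq_mul, norm_mul]
    gcongr
    exact (hd i).trans (le_abs_self C)
  let L : ℓ²(ι, ℝ) →ₗ[ℝ] ℓ²(ι, ℝ) :=
    { toFun := fun a => ⟨fun i => d i * a i, (lp.memℓp (C • a)).mono' (hle a)⟩
      map_add' := fun a b => by ext i; exact mul_add _ _ _
      map_smul' := fun c a => by ext i; exact mul_left_comm _ _ _ }
  refine ⟨L.mkContinuous |C| fun a => ?_, fun i => ?_⟩
  · refine (lp.norm_mono (by simp) (hle a)).trans ?_
    rw [norm_smul, Real.norm_eq_abs]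
  · ext j
    change d j * (lp.single 2 i (1 : ℝ) : ℓ²(ι, ℝ)) j = d i * (lp.single 2 i (1 : ℝ) : ℓ²(ι, ℝ)) j
    by_cases h : j = i
    · rw [h]
    · rw [lp.single_apply_ne _ _ _ h, mul_zero, mul_zero]

/-- Normalising the family leaves its lengths as a bounded diagonal operator, followed by an
isometry. -/
lemma exists_clm_of_orthogonal {E : Type*} [NormedAddCommGroup E] [InnerProductSpace ℝ E]
    [CompleteSpace E] {x : ι → E} (hx : Pairwise fun i j => inner ℝ (x i) (x j) = 0)
    (h0 : ∀ i, x i ≠ 0) {C : ℝ} (hC : ∀ i, ‖x i‖ ≤ C) :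
    ∃ T : ℓ²(ι, ℝ) →L[ℝ] E, ∀ i, T (lp.single 2 i (1 : ℝ)) = x i := by
  have he : Orthonormal ℝ fun i => ‖x i‖⁻¹ • x i := by
    refine ⟨fun i => ?_, fun i j hij => ?_⟩
    · rw [norm_smul, norm_inv, norm_norm, inv_mul_cancel₀ (norm_ne_zero_iff.2 (h0 i))]
    · beta_reduce
      rw [real_inner_smul_left, real_inner_smul_right, hx hij, mul_zero, mul_zero]
  obtain ⟨V, hV⟩ := exists_clm_of_orthonormal he
  obtain ⟨D, hD⟩ := exists_diagonal_clm (fun i => ‖x i‖) (C := C) (by simpa using hC)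
  refine ⟨V.toContinuousLinearMap.comp D, fun i => ?_⟩
  rw [ContinuousLinearMap.comp_apply, hD, map_smul, LinearIsometry.coe_toContinuousLinearMap, hV,
    smul_smul, mul_inv_cancel₀ (norm_ne_zero_iff.2 (h0 i)), one_smul]

/-- By Cauchy–Schwarz the series `∑ aᵢ xᵢ` converges absolutely. No orthogonality is used, so the
target may carry the supremum norm. -/
lemma exists_clm_of_summable_sq {E : Type*} [NormedAddCommGroup E] [NormedSpace ℝ E]
    [CompleteSpace E] {x : ι → E} (hx : Summable fun i => ‖x i‖ ^ 2) :
    ∃ S : ℓ²(ι, ℝ) →L[ℝ] E, ∀ i, S (lp.single 2 i (1 : ℝ)) = x i := by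
  have hmem : Memℓp (fun i => ‖x i‖) 2 := memℓp_gen (by simpa using hx)
  set y : ℓ²(ι, ℝ) := ⟨fun i => ‖x i‖, hmem⟩ with hy
  have hpq : (2 : ℝ≥0∞).toReal.HolderConjugate (2 : ℝ≥0∞).toReal := by
    simpa using Real.HolderConjugate.two_two
  have hn : ∀ (a : ℓ²(ι, ℝ)) i, ‖a i • x i‖ = ‖a i‖ * ‖y i‖ := fun a i => by
    rw [norm_smul, hy, norm_norm]
  have hs : ∀ a : ℓ²(ι, ℝ), Summable fun i => ‖a i • x i‖ := fun a => by
    simp only [hn]; exact lp.summable_mul hpq a y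
  let L : ℓ²(ι, ℝ) →ₗ[ℝ] E :=
    { toFun := fun a => ∑' i, a i • x i
      map_add' := fun a b => by
        rw [← (hs a).of_norm.tsum_add (hs b).of_norm]
        exact tsum_congr fun i => add_smul _ _ _
      map_smul' := fun c a => by
        rw [RingHom.id_apply, ← (hs a).of_norm.tsum_const_smul c]
        exact tsum_congr fun i => mul_smul _ _ _ }
  refine ⟨L.mkContinuous ‖y‖ fun a => ?_, fun i => ?_⟩
  · refine (norm_tsum_le_tsum_norm (hs a)).trans ?_
    simp only [hn]
    rw [mul_comm]
    exact lp.tsum_mul_le_mul_norm' hpq a y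
  · change ∑' j, (lp.single 2 i (1 : ℝ) : ℓ²(ι, ℝ)) j • x j = x i
    rw [tsum_eq_single i fun j hj => by rw [lp.single_apply_ne _ _ _ hj, zero_smul],
      lp.single_apply_self, one_smul]

end SequenceSpace

/-! ### The symmetric Fourier modes, their derivatives, products and integrals. -/

section Modes

/-- The derivative `∂ₓᵃ ∂_yᵇ` of `cos (k m x) cos (k n y)`. -/
noncomputable def tens (k : ℝ) (m n : ℤ) (a b : ℕ) (p : ℝ × ℝ) : ℝ :=
  ((k * m) ^ a * Real.cos (k * m * p.1 + a * (Real.pi / 2)))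
    * ((k * n) ^ b * Real.cos (k * n * p.2 + b * (Real.pi / 2)))

/-- The derivative `∂ₓᵃ ∂_yᵇ` of `cos (k m x) cos (k n y) + cos (k n x) cos (k m y)`. -/
noncomputable def mode (k : ℝ) (m n : ℤ) (a b : ℕ) (p : ℝ × ℝ) : ℝ :=
  tens k m n a b p + tens k n m a b p

lemma mode_zero (k : ℝ) (m n : ℤ) (p : ℝ × ℝ) :
    mode k m n 0 0 p = Real.cos (k * m * p.1) * Real.cos (k * n * p.2)
      + Real.cos (k * n * p.1) * Real.cos (k * m * p.2) := by
  simp [mode, tens]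

lemma contDiff_tens (k : ℝ) (m n : ℤ) (a b : ℕ) : ContDiff ℝ (⊤ : ℕ∞) (tens k m n a b) := by
  unfold tens
  fun_prop

lemma contDiff_mode (k : ℝ) (m n : ℤ) (a b : ℕ) : ContDiff ℝ (⊤ : ℕ∞) (mode k m n a b) :=
  (contDiff_tens k m n a b).add (contDiff_tens k n m a b)

/-- Differentiating a cosine shifts its phase by a quarter period; one formula then serves all
derivatives, and orthogonality is proved once for all orders. -/
lemma hasDerivAt_cos_shift (c : ℝ) (a : ℕ) (t : ℝ) :
    HasDerivAt (fun t => c ^ a * Real.cos (c * t + a * (Real.pi / 2)))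
      (c ^ (a + 1) * Real.cos (c * t + (a + 1 : ℕ) * (Real.pi / 2))) t := by
  have h := ((((hasDerivAt_id' t).const_mul c).add_const (a * (Real.pi / 2))).cos).const_mul (c ^ a)
  rw [Nat.cast_succ, show c * t + ((a : ℝ) + 1) * (Real.pi / 2)
    = c * t + a * (Real.pi / 2) + Real.pi / 2 by ring, Real.cos_add_pi_div_two,
    show c ^ (a + 1) * -Real.sin (c * t + a * (Real.pi / 2))
      = c ^ a * (-Real.sin (c * t + a * (Real.pi / 2)) * (c * 1)) by ring]
  exact h

lemma hasDerivAt_tens_fst (k : ℝ) (m n : ℤ) (a b : ℕ) (p : ℝ × ℝ) :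
    HasDerivAt (fun t => tens k m n a b (t, p.2)) (tens k m n (a + 1) b p) p.1 :=
  (hasDerivAt_cos_shift (k * m) a p.1).mul_const
    ((k * n) ^ b * Real.cos (k * n * p.2 + b * (Real.pi / 2)))

lemma hasDerivAt_tens_snd (k : ℝ) (m n : ℤ) (a b : ℕ) (p : ℝ × ℝ) :
    HasDerivAt (fun t => tens k m n a b (p.1, t)) (tens k m n a (b + 1) p) p.2 :=
  (hasDerivAt_cos_shift (k * n) b p.2).const_mul
    ((k * m) ^ a * Real.cos (k * m * p.1 + a * (Real.pi / 2)))

lemma pderivX_mode (k : ℝ) (m n : ℤ) (a b : ℕ) :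
    pderivX (mode k m n a b) = mode k m n (a + 1) b := by
  funext p
  exact ((hasDerivAt_tens_fst k m n a b p).add (hasDerivAt_tens_fst k n m a b p)).deriv

lemma pderivY_mode (k : ℝ) (m n : ℤ) (a b : ℕ) :
    pderivY (mode k m n a b) = mode k m n a (b + 1) := by
  funext p
  exact ((hasDerivAt_tens_snd k m n a b p).add (hasDerivAt_tens_snd k n m a b p)).deriv

lemma iterate_pderiv_mode (k : ℝ) (m n : ℤ) (a b : ℕ) :
    pderivY^[b] (pderivX^[a] (mode k m n 0 0)) = mode k m n a b := by
  have hX : pderivX^[a] (mode k m n 0 0) = mode k m n a 0 := by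
    induction a with
    | zero => rfl
    | succ a ih => rw [Function.iterate_succ_apply', ih, pderivX_mode]
  rw [hX]
  induction b with
  | zero => rfl
  | succ b ih => rw [Function.iterate_succ_apply', ih, pderivY_mode]

lemma periodic_mode {k : ℝ} (hk : 0 < k) (m n : ℤ) : SquarePeriodic k (mode k m n 0 0) := by
  have h : ∀ (j : ℤ) (t : ℝ), Real.cos (k * j * (t + 2 * Real.pi / k)) = Real.cos (k * j * t) := by
    intro j t
    rw [show k * j * (t + 2 * Real.pi / k) = k * j * t + j * (2 * Real.pi) by field_simp]
    exact Real.cos_add_int_mul_two_pi _ _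
  intro p
  constructor <;> simp only [mode_zero, h]

lemma mode_squareGroup (k : ℝ) (m n : ℤ) {S : Equiv.Perm (ℝ × ℝ)} (hS : S ∈ squareGroup) :
    ∀ p, mode k m n 0 0 (S p) = mode k m n 0 0 p := by
  induction hS using Subgroup.closure_induction with
  | mem x hx =>
    intro p
    rcases hx with rfl | rfl
    · simp [mode_zero, quarterTurn]; ring
    · simp [mode_zero, axisReflection]
  | one => intro p; rfl
  | mul x y _ _ hx hy => intro p; rw [Equiv.Perm.mul_apply, hx, hy]
  | inv x _ hx => intro p; rw [← hx (x⁻¹ p)]; simp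

lemma abs_tens_le (k : ℝ) (m n : ℤ) (a b : ℕ) (p : ℝ × ℝ) :
    |tens k m n a b p| ≤ |k * m| ^ a * |k * n| ^ b := by
  rw [tens, abs_mul, abs_mul, abs_mul, abs_pow, abs_pow]
  gcongr
  · exact mul_le_of_le_one_right (by positivity) (Real.abs_cos_le_one _)
  · exact mul_le_of_le_one_right (by positivity) (Real.abs_cos_le_one _)

lemma mode_laplacian (k : ℝ) (m n : ℤ) (p : ℝ × ℝ) :
    mode k m n 2 0 p + mode k m n 0 2 p = -(k ^ 2 * (m ^ 2 + n ^ 2)) * mode k m n 0 0 p := by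
  have h : ∀ x : ℝ, Real.cos (x + 2 * (Real.pi / 2)) = -Real.cos x := fun x => by
    rw [mul_div_cancel₀ _ (by norm_num), Real.cos_add_pi]
  simp only [mode, tens, Nat.cast_ofNat, h, Nat.cast_zero, zero_mul, add_zero, pow_zero, one_mul]
  ring

lemma mode_swap (k : ℝ) (m n : ℤ) : mode k m n 0 0 = mode k n m 0 0 := by
  funext p; simp only [mode_zero]; ring

lemma mode_neg_left (k : ℝ) (m n : ℤ) : mode k (-m) n 0 0 = mode k m n 0 0 := by
  funext p; simp [mode_zero]

lemma mode_neg_right (k : ℝ) (m n : ℤ) : mode k m (-n) 0 0 = mode k m n 0 0 := by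
  funext p; simp [mode_zero]

/-- Every mode is one with ordered natural indices. -/
lemma exists_nat_mode_eq (k : ℝ) (m n : ℤ) :
    ∃ i j : ℕ, j ≤ i ∧ mode k m n 0 0 = mode k i j 0 0 := by
  have h : mode k m n 0 0 = mode k m.natAbs n.natAbs 0 0 := by
    rcases Int.natAbs_eq m with hm | hm <;> rcases Int.natAbs_eq n with hn | hn <;>
    (conv_lhs => rw [hm, hn]) <;> simp only [mode_neg_left, mode_neg_right]
  rcases le_total n.natAbs m.natAbs with hle | hle
  · exact ⟨_, _, hle, h⟩
  · exact ⟨_, _, hle, h.trans (mode_swap _ _ _)⟩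

/-- The product-to-sum formulas in both variables; hence the span of the modes is an algebra. -/
lemma mode_mul_mode (k : ℝ) (m n i j : ℤ) (p : ℝ × ℝ) :
    mode k m n 0 0 p * mode k i j 0 0 p = 1 / 4 *
      (mode k (m + i) (n + j) 0 0 p + mode k (m + i) (n - j) 0 0 p
        + mode k (m - i) (n + j) 0 0 p + mode k (m - i) (n - j) 0 0 p
        + mode k (m + j) (n + i) 0 0 p + mode k (m + j) (n - i) 0 0 p
        + mode k (m - j) (n + i) 0 0 p + mode k (m - j) (n - i) 0 0 p) := by
  have ha : ∀ (a b : ℤ) (t : ℝ), Real.cos (k * ((a + b : ℤ) : ℝ) * t)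
      = Real.cos (k * a * t) * Real.cos (k * b * t)
        - Real.sin (k * a * t) * Real.sin (k * b * t) := by
    intro a b t
    rw [← Real.cos_add]; push_cast; ring_nf
  have hs : ∀ (a b : ℤ) (t : ℝ), Real.cos (k * ((a - b : ℤ) : ℝ) * t)
      = Real.cos (k * a * t) * Real.cos (k * b * t)
        + Real.sin (k * a * t) * Real.sin (k * b * t) := by
    intro a b t
    rw [← Real.cos_sub]; push_cast; ring_nf
  simp only [mode_zero, ha, hs]
  ring

/-! ### Integrals of products of modes -/

lemma integral_cos_shift {k : ℝ} (hk : 0 < k) {j : ℤ} (hj : j ≠ 0) (c : ℝ) :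
    ∫ t in Ioo (-(Real.pi / k)) (Real.pi / k), Real.cos (k * j * t + c) = 0 := by
  have hj' : (j : ℝ) ≠ 0 := by exact_mod_cast hj
  set f : ℝ → ℝ := fun t => Real.sin (k * j * t + c) / (k * j) with hf
  have hd : deriv f = fun t => Real.cos (k * j * t + c) := by
    funext t
    have h := ((((hasDerivAt_id' t).const_mul (k * j)).add_const c).sin).div_const (k * j)
    rw [h.deriv]
    field_simp
  rw [← hd]
  refine integral_Ioo_deriv_eq_zero hk (by rw [hf]; fun_prop) fun t => ?_
  simp only [hf]
  rw [show k * j * (t + 2 * Real.pi / k) + c = k * j * t + c + j * (2 * Real.pi) by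
    field_simp; ring, Real.sin_add_int_mul_two_pi]

/-- `∫ cos (k m t + c) cos (k n t + c)` over a period. -/
noncomputable def cosInt (k : ℝ) (m n : ℤ) (c : ℝ) : ℝ :=
  ∫ t in Ioo (-(Real.pi / k)) (Real.pi / k), Real.cos (k * m * t + c) * Real.cos (k * n * t + c)

lemma cosInt_eq {k : ℝ} (m n : ℤ) (c : ℝ) :
    cosInt k m n c = 1 / 2 *
      ((∫ t in Ioo (-(Real.pi / k)) (Real.pi / k), Real.cos (k * ((m + n : ℤ) : ℝ) * t + 2 * c))
      + ∫ t in Ioo (-(Real.pi / k)) (Real.pi / k), Real.cos (k * ((m - n : ℤ) : ℝ) * t + 0)) := by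
  have hint : ∀ a b : ℝ,
      IntegrableOn (fun t => Real.cos (a * t + b)) (Ioo (-(Real.pi / k)) (Real.pi / k)) :=
    fun a b =>
    (Continuous.integrableOn_Icc (by fun_prop)).mono_set Ioo_subset_Icc_self
  rw [cosInt, ← integral_add (hint _ _) (hint _ _), ← integral_const_mul]
  refine integral_congr_ae (Eventually.of_forall fun t => ?_)
  beta_reduce
  rw [show k * ((m + n : ℤ) : ℝ) * t + 2 * c = (k * m * t + c) + (k * n * t + c) by push_cast; ring,
    show k * ((m - n : ℤ) : ℝ) * t + 0 = (k * m * t + c) - (k * n * t + c) by push_cast; ring]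
  generalize k * m * t + c = x
  generalize k * n * t + c = y
  rw [Real.cos_add, Real.cos_sub]
  ring

/-- For distinct naturals both frequencies `m + n` and `m - n` are nonzero; integers with `m = -n`
would break this. -/
lemma cosInt_of_ne {k : ℝ} (hk : 0 < k) {m n : ℕ} (h : m ≠ n) (c : ℝ) : cosInt k m n c = 0 := by
  rw [cosInt_eq, integral_cos_shift hk (by omega), integral_cos_shift hk (by omega)]
  simp

lemma volume_real_Ioo {k : ℝ} (hk : 0 < k) :
    volume.real (Ioo (-(Real.pi / k)) (Real.pi / k)) = 2 * Real.pi / k := by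
  have : 0 < Real.pi / k := by positivity
  rw [Real.volume_real_Ioo_of_le (by linarith)]
  ring

lemma cosInt_self {k : ℝ} (hk : 0 < k) {m : ℤ} (h : m ≠ 0) (c : ℝ) :
    cosInt k m m c = Real.pi / k := by
  rw [cosInt_eq, integral_cos_shift hk (by omega)]
  simp only [sub_self, Int.cast_zero, mul_zero, zero_mul, add_zero, Real.cos_zero]
  rw [setIntegral_const, volume_real_Ioo hk, smul_eq_mul]
  ring

lemma cosInt_zero {k : ℝ} (hk : 0 < k) (c : ℝ) :
    cosInt k 0 0 c = Real.cos c ^ 2 * (2 * Real.pi / k) := by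
  simp only [cosInt, Int.cast_zero, mul_zero, zero_mul, zero_add]
  rw [setIntegral_const, volume_real_Ioo hk, smul_eq_mul]
  ring

lemma cosInt_self_ge {k : ℝ} (hk : 0 < k) (m : ℤ) : Real.pi / k ≤ cosInt k m m 0 := by
  by_cases h : m = 0
  · have : 0 < Real.pi / k := by positivity
    rw [h, cosInt_zero hk, Real.cos_zero, mul_div_assoc]
    linarith
  · rw [cosInt_self hk h]

lemma cellMeasure_eq_prod (k : ℝ) : cellMeasure k =
    (volume.restrict (Ioo (-(Real.pi / k)) (Real.pi / k))).prod
      (volume.restrict (Ioo (-(Real.pi / k)) (Real.pi / k))) := by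
  rw [cellMeasure, cell, Measure.volume_eq_prod, Measure.prod_restrict]

lemma integral_tens_mul_tens (k : ℝ) (m n i j : ℤ) (a b : ℕ) :
    ∫ p, tens k m n a b p * tens k i j a b p ∂(cellMeasure k)
      = (k * m) ^ a * (k * n) ^ b * (k * i) ^ a * (k * j) ^ b
        * (cosInt k m i (a * (Real.pi / 2)) * cosInt k n j (b * (Real.pi / 2))) := by
  rw [cosInt, cosInt, ← integral_prod_mul, ← cellMeasure_eq_prod, ← integral_const_mul]
  refine integral_congr_ae (Eventually.of_forall fun p => ?_)
  simp only [tens]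
  ring

lemma integral_mode_mul_mode (k : ℝ) (m n i j : ℤ) (a b : ℕ) :
    ∫ p, mode k m n a b p * mode k i j a b p ∂(cellMeasure k)
      = ((k * m) ^ a * (k * n) ^ b * (k * i) ^ a * (k * j) ^ b
          * (cosInt k m i (a * (Real.pi / 2)) * cosInt k n j (b * (Real.pi / 2)))
        + (k * m) ^ a * (k * n) ^ b * (k * j) ^ a * (k * i) ^ b
          * (cosInt k m j (a * (Real.pi / 2)) * cosInt k n i (b * (Real.pi / 2))))
        + ((k * n) ^ a * (k * m) ^ b * (k * i) ^ a * (k * j) ^ b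
          * (cosInt k n i (a * (Real.pi / 2)) * cosInt k m j (b * (Real.pi / 2)))
        + (k * n) ^ a * (k * m) ^ b * (k * j) ^ a * (k * i) ^ b
          * (cosInt k n j (a * (Real.pi / 2)) * cosInt k m i (b * (Real.pi / 2)))) := by
  have hint : ∀ m n i j : ℤ,
      Integrable (fun p => tens k m n a b p * tens k i j a b p) (cellMeasure k) := fun m n i j =>
    integrable_continuous k
      ((contDiff_tens k m n a b).continuous.mul (contDiff_tens k i j a b).continuous)
  rw [← integral_tens_mul_tens, ← integral_tens_mul_tens, ← integral_tens_mul_tens,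
    ← integral_tens_mul_tens, ← integral_add (hint _ _ _ _) (hint _ _ _ _),
    ← integral_add (hint _ _ _ _) (hint _ _ _ _), ← integral_add]
  · refine integral_congr_ae (Eventually.of_forall fun p => ?_)
    simp only [mode]
    ring
  · exact (hint _ _ _ _).add (hint _ _ _ _)
  · exact (hint _ _ _ _).add (hint _ _ _ _)

lemma integral_mode_mul_mode_of_ne {k : ℝ} (hk : 0 < k) {m n i j : ℕ} (hmn : n ≤ m) (hij : j ≤ i)
    (h : (m, n) ≠ (i, j)) (a b : ℕ) :
    ∫ p, mode k m n a b p * mode k i j a b p ∂(cellMeasure k) = 0 := by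
  have h1 : m ≠ i ∨ n ≠ j := by
    by_contra hc
    push Not at hc
    exact h (by rw [hc.1, hc.2])
  -- A mode is a sum of two swapped tensors, so the crossed pairing must vanish too; the ordering of
  -- both pairs excludes `(m, n) = (j, i)`.
  have h2 : m ≠ j ∨ n ≠ i := by
    by_contra hc
    push Not at hc
    omega
  have e : ∀ c d, cosInt k m i c * cosInt k n j d = 0 ∧ cosInt k n j c * cosInt k m i d = 0 := by
    intro c d
    rcases h1 with h1 | h1 <;> simp [cosInt_of_ne hk h1]
  have e' : ∀ c d, cosInt k m j c * cosInt k n i d = 0 ∧ cosInt k n i c * cosInt k m j d = 0 := by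
    intro c d
    rcases h2 with h2 | h2 <;> simp [cosInt_of_ne hk h2]
  rw [integral_mode_mul_mode, (e _ _).1, (e _ _).2, (e' _ _).1, (e' _ _).2]
  ring

/-- The diagonal terms are at least `(π/k)²` each and the cross terms are squares. A lower bound
uniform in `m, n` is what the estimate of the solution operator needs. -/
lemma integral_mode_sq_ge {k : ℝ} (hk : 0 < k) (m n : ℤ) :
    2 * (Real.pi / k) ^ 2 ≤ ∫ p, mode k m n 0 0 p * mode k m n 0 0 p ∂(cellMeasure k) := by
  have hcomm : cosInt k n m 0 = cosInt k m n 0 := by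
    unfold cosInt
    simp only [mul_comm]
  rw [integral_mode_mul_mode]
  simp only [Nat.cast_zero, zero_mul, pow_zero, one_mul, hcomm]
  have h1 := cosInt_self_ge hk m
  have h2 := cosInt_self_ge hk n
  have : 0 < Real.pi / k := by positivity
  nlinarith [mul_le_mul h1 h2 this.le (this.le.trans h1), sq_nonneg (cosInt k m n 0)]

end Modes

/-! ### The modes in the sup norm, in `L²` and in the jet space. -/

section Spaces

open scoped lp ENNReal BoundedContinuousFunction

/-- The class in `L²` of a bounded continuous function. -/
noncomputable def toL2 (k : ℝ) : (ℝ × ℝ →ᵇ ℝ) →L[ℝ] L2per k :=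
  BoundedContinuousFunction.toLp 2 (cellMeasure k) ℝ

lemma coeFn_toL2 (k : ℝ) (u : ℝ × ℝ →ᵇ ℝ) : toL2 k u =ᵐ[cellMeasure k] u :=
  BoundedContinuousFunction.coeFn_toLp 2 (cellMeasure k) ℝ u

lemma toL2_eq_toLp (k : ℝ) (u : ℝ × ℝ →ᵇ ℝ) {f : ℝ × ℝ → ℝ} (hf : MemLp f 2 (cellMeasure k))
    (h : f =ᵐ[cellMeasure k] u) : hf.toLp = toL2 k u :=
  Lp.ext (hf.coeFn_toLp.trans (h.trans (coeFn_toL2 k u).symm))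

lemma inner_eq_integral (k : ℝ) {x y : L2per k} {f h : ℝ × ℝ → ℝ} (hx : x =ᵐ[cellMeasure k] f)
    (hy : y =ᵐ[cellMeasure k] h) : inner ℝ x y = ∫ p, f p * h p ∂(cellMeasure k) := by
  rw [L2.inner_def]
  refine integral_congr_ae ?_
  filter_upwards [hx, hy] with p h1 h2
  rw [h1, h2, real_inner_eq_re_inner, RCLike.inner_apply]
  simp [mul_comm]

lemma inner_toL2 (k : ℝ) (u v : ℝ × ℝ →ᵇ ℝ) :
    inner ℝ (toL2 k u) (toL2 k v) = ∫ p, u p * v p ∂(cellMeasure k) :=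
  inner_eq_integral k (coeFn_toL2 k u) (coeFn_toL2 k v)

lemma integral_mul_eq_inner (k : ℝ) (v : L2per k) {u : ℝ × ℝ → ℝ} (hu : Continuous u) :
    ∫ p, v p * u p ∂(cellMeasure k) = inner ℝ (memLp_of_continuous k hu).toLp v := by
  rw [real_inner_comm]
  exact (inner_eq_integral k (ae_eq_refl _) (MemLp.coeFn_toLp _)).symm

/-- The modes as bounded continuous functions. -/
noncomputable def modeB (k : ℝ) (m n : ℤ) : ℝ × ℝ →ᵇ ℝ :=
  BoundedContinuousFunction.ofNormedAddCommGroup (mode k m n 0 0)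
    (contDiff_mode k m n 0 0).continuous 2 fun p => by
      refine (abs_add_le _ _).trans ?_
      linarith [by simpa using abs_tens_le k m n 0 0 p, by simpa using abs_tens_le k n m 0 0 p]

lemma modeB_apply (k : ℝ) (m n : ℤ) (p : ℝ × ℝ) : modeB k m n p = mode k m n 0 0 p := rfl

lemma norm_modeB_le (k : ℝ) (m n : ℤ) : ‖modeB k m n‖ ≤ 2 :=
  BoundedContinuousFunction.norm_ofNormedAddCommGroup_le _ (by norm_num) _

lemma inner_modeB (k : ℝ) (m n i j : ℤ) :
    inner ℝ (toL2 k (modeB k m n)) (toL2 k (modeB k i j))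
      = ∫ p, mode k m n 0 0 p * mode k i j 0 0 p ∂(cellMeasure k) :=
  inner_toL2 k _ _

lemma inner_modeB_of_ne {k : ℝ} (hk : 0 < k) {m n i j : ℕ} (hmn : n ≤ m) (hij : j ≤ i)
    (h : (m, n) ≠ (i, j)) :
    inner ℝ (toL2 k (modeB k m n)) (toL2 k (modeB k i j)) = 0 := by
  rw [inner_modeB, integral_mode_mul_mode_of_ne hk hmn hij h]

lemma norm_toL2_modeB_ge {k : ℝ} (hk : 0 < k) (m n : ℤ) :
    Real.pi / k ≤ ‖toL2 k (modeB k m n)‖ := by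
  have h : 0 < Real.pi / k := by positivity
  refine le_of_sq_le_sq ?_ (norm_nonneg _)
  rw [← real_inner_self_eq_norm_sq, inner_modeB]
  nlinarith [integral_mode_sq_ge hk m n]

/-- The function `mode` together with its derivatives up to order two. -/
noncomputable def modeJet (k : ℝ) (m n : ℤ) : JetSpace k :=
  WithLp.toLp 2 fun α =>
    (memLp_of_continuous k (contDiff_mode k m n α.1.1 α.1.2).continuous).toLp

lemma coeFn_modeJet (k : ℝ) (m n : ℤ) (α : MultiIdx) :
    modeJet k m n α =ᵐ[cellMeasure k] mode k m n α.1.1 α.1.2 :=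
  MemLp.coeFn_toLp (memLp_of_continuous k (contDiff_mode k m n α.1.1 α.1.2).continuous)

lemma modeJet_idx0 (k : ℝ) (m n : ℤ) : modeJet k m n idx0 = toL2 k (modeB k m n) :=
  toL2_eq_toLp k _
    (memLp_of_continuous k (contDiff_mode k m n 0 0).continuous) (ae_eq_refl _)

lemma modeJet_laplacian (k : ℝ) (m n : ℤ) :
    modeJet k m n idxXX + modeJet k m n idxYY
      = -(k ^ 2 * (m ^ 2 + n ^ 2)) • toL2 k (modeB k m n) := by
  refine Lp.ext ?_
  filter_upwards [Lp.coeFn_add (modeJet k m n idxXX) (modeJet k m n idxYY),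
    coeFn_modeJet k m n idxXX, coeFn_modeJet k m n idxYY,
    Lp.coeFn_smul (-(k ^ 2 * ((m : ℝ) ^ 2 + (n : ℝ) ^ 2))) (toL2 k (modeB k m n)),
    coeFn_toL2 k (modeB k m n)] with p h1 h2 h3 h4 h5
  rw [h1, h4, Pi.add_apply, Pi.smul_apply, h2, h3, h5, smul_eq_mul, modeB_apply,
    ← mode_laplacian]
  rfl

lemma isWeakDeriv_modeJet {k : ℝ} (hk : 0 < k) (m n : ℤ) (α : MultiIdx) :
    IsWeakDeriv k α (modeJet k m n idx0) (modeJet k m n α) := by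
  intro φ hφ hφp
  have e1 : ∫ p, modeJet k m n idx0 p * classicalDeriv α φ p ∂(cellMeasure k)
      = ∫ p, mode k m n 0 0 p * classicalDeriv α φ p ∂(cellMeasure k) :=
    integral_congr_ae (by filter_upwards [coeFn_modeJet k m n idx0] with p hp; rw [hp]; rfl)
  have e2 : ∫ p, modeJet k m n α p * φ p ∂(cellMeasure k)
      = ∫ p, mode k m n α.1.1 α.1.2 p * φ p ∂(cellMeasure k) :=
    integral_congr_ae (by filter_upwards [coeFn_modeJet k m n α] with p hp; rw [hp])
  have hY := integral_mul_iterate_pderivY hk hφ hφp α.1.2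
  have hX := integral_mul_iterate_pderivX hk hY.1 hY.2.1 α.1.1
  have hx := integral_mul_iterate_pderivX hk (contDiff_mode k m n 0 0) (periodic_mode hk m n) α.1.1
  rw [e1, e2, classicalDeriv, hX.2.2 _ (contDiff_mode k m n 0 0) (periodic_mode hk m n),
    hY.2.2 _ hx.1 hx.2.1, iterate_pderiv_mode, pow_add, mul_assoc]

lemma inner_modeJet (k : ℝ) (m n i j : ℤ) :
    inner ℝ (modeJet k m n) (modeJet k i j) = ∑ α : MultiIdx,
      ∫ p, mode k m n α.1.1 α.1.2 p * mode k i j α.1.1 α.1.2 p ∂(cellMeasure k) := by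
  rw [PiLp.inner_apply]
  exact Finset.sum_congr rfl fun α _ =>
    inner_eq_integral k (coeFn_modeJet k m n α) (coeFn_modeJet k i j α)

lemma pow_mul_pow_le (x y : ℝ) (α : MultiIdx) :
    x ^ (α.1.1 : ℕ) * y ^ (α.1.2 : ℕ) ≤ 1 + (x ^ 2 + y ^ 2) := by
  obtain ⟨⟨a, b⟩, h⟩ := α
  fin_cases a <;> fin_cases b <;> simp_all <;>
    nlinarith [sq_nonneg (x - 1), sq_nonneg (y - 1), sq_nonneg (x - y), sq_nonneg x, sq_nonneg y]

lemma abs_mode_le (k : ℝ) (m n : ℤ) (α : MultiIdx) (p : ℝ × ℝ) :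
    |mode k m n α.1.1 α.1.2 p| ≤ 2 * (1 + k ^ 2 * (m ^ 2 + n ^ 2)) := by
  refine (abs_add_le _ _).trans ?_
  have h1 := (abs_tens_le k m n α.1.1 α.1.2 p).trans
    (pow_mul_pow_le _ _ α)
  have h2 := (abs_tens_le k n m α.1.1 α.1.2 p).trans
    (pow_mul_pow_le _ _ α)
  rw [sq_abs, sq_abs] at h1 h2
  linarith

/-- Two derivatives cost no more than the growth of the Laplace eigenvalue, so dividing by the
eigenvalue gives a bounded family in `H²`. -/
lemma norm_modeJet_le (k : ℝ) : ∃ C, 0 ≤ C ∧ ∀ m n : ℤ,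
    ‖modeJet k m n‖ ≤ C * (1 + k ^ 2 * (m ^ 2 + n ^ 2)) := by
  set V := (cellMeasure k).real univ
  set c : ℝ := (Fintype.card MultiIdx : ℝ) * (4 * V)
  have hV : 0 ≤ V := measureReal_nonneg
  refine ⟨Real.sqrt c, Real.sqrt_nonneg _, fun m n => ?_⟩
  set R : ℝ := 1 + k ^ 2 * ((m : ℝ) ^ 2 + (n : ℝ) ^ 2)
  have hR : 0 ≤ R := by positivity
  refine le_of_sq_le_sq ?_ (by positivity)
  rw [mul_pow, Real.sq_sqrt (by positivity), ← real_inner_self_eq_norm_sq, inner_modeJet]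
  have : ∀ α : MultiIdx, ∫ p, mode k m n α.1.1 α.1.2 p * mode k m n α.1.1 α.1.2 p ∂(cellMeasure k)
      ≤ 4 * V * R ^ 2 := by
    intro α
    have hc := (contDiff_mode k m n α.1.1 α.1.2).continuous
    calc _ ≤ ∫ _p, (2 * R) ^ 2 ∂(cellMeasure k) := by
          refine integral_mono (integrable_continuous k (hc.mul hc)) (integrable_const _)
            fun p => ?_
          have := abs_mode_le k m n α p
          beta_reduce
          rw [← sq, ← sq_abs]
          gcongr
      _ = _ := by rw [integral_const, smul_eq_mul]; ring
  calc _ ≤ ∑ _α : MultiIdx, 4 * V * R ^ 2 := Finset.sum_le_sum fun α _ => this α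
    _ = c * R ^ 2 := by rw [Finset.sum_const, Finset.card_univ, nsmul_eq_mul]; ring

lemma modeJet_ne_zero {k : ℝ} (hk : 0 < k) (m n : ℤ) : modeJet k m n ≠ 0 := by
  intro h
  have h1 := norm_toL2_modeB_ge hk m n
  rw [← modeJet_idx0, h, PiLp.zero_apply, norm_zero] at h1
  have : 0 < Real.pi / k := by positivity
  linarith

end Spaces

/-! ### The closed span and algebra of the modes; estimates for the inverse eigenvalues. -/

section Operators

open scoped lp ENNReal BoundedContinuousFunction

lemma clm_lp_mem {ι : Type*} [DecidableEq ι] {F : Type*} [NormedAddCommGroup F] [NormedSpace ℝ F]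
    (f : ℓ²(ι, ℝ) →L[ℝ] F) {V : Submodule ℝ F} (hV : IsClosed (V : Set F))
    (h : ∀ i, f (lp.single 2 i (1 : ℝ)) ∈ V) (z : ℓ²(ι, ℝ)) : f z ∈ V := by
  have hs := (lp.hasSum_single (by simp) z).map f f.continuous
  refine hV.mem_of_tendsto hs (Eventually.of_forall fun s => sum_mem fun i _ => ?_)
  have : (lp.single 2 i (z i) : ℓ²(ι, ℝ)) = z i • lp.single 2 i (1 : ℝ) := by
    rw [← lp.single_smul, smul_eq_mul, mul_one]
  rw [Function.comp_apply, this, map_smul]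
  exact V.smul_mem _ (h i)

/-- The closed algebra generated by the modes. -/
noncomputable def modeAlg (k : ℝ) : Subalgebra ℝ (ℝ × ℝ →ᵇ ℝ) :=
  ((Submodule.span ℝ (range fun q : ℤ × ℤ => modeB k q.1 q.2)).toSubalgebra
    (by
      have : (1 : ℝ × ℝ →ᵇ ℝ) = (1 / 2 : ℝ) • modeB k 0 0 := by
        ext p
        simp [modeB_apply, mode_zero]
        norm_num
      rw [this]
      exact Submodule.smul_mem _ _ (Submodule.subset_span ⟨(0, 0), rfl⟩))
    (by
      intro x y hx hy
      induction hx, hy using Submodule.span_induction₂ with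
      | mem_mem x y hx hy =>
        obtain ⟨⟨m, n⟩, rfl⟩ := hx
        obtain ⟨⟨i, j⟩, rfl⟩ := hy
        have : modeB k m n * modeB k i j = (1 / 4 : ℝ) •
            (modeB k (m + i) (n + j) + modeB k (m + i) (n - j)
              + modeB k (m - i) (n + j) + modeB k (m - i) (n - j)
              + modeB k (m + j) (n + i) + modeB k (m + j) (n - i)
              + modeB k (m - j) (n + i) + modeB k (m - j) (n - i)) := by
          ext p
          exact mode_mul_mode k m n i j p
        have hm : ∀ a b : ℤ, modeB k a b ∈
            Submodule.span ℝ (range fun q : ℤ × ℤ => modeB k q.1 q.2) :=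
          fun a b => Submodule.subset_span ⟨(a, b), rfl⟩
        rw [this]
        exact Submodule.smul_mem _ _ (add_mem (add_mem (add_mem (add_mem (add_mem (add_mem (add_mem
          (hm _ _) (hm _ _)) (hm _ _)) (hm _ _)) (hm _ _)) (hm _ _)) (hm _ _)) (hm _ _))
      | zero_left y _ => rw [zero_mul]; exact zero_mem _
      | zero_right x _ => rw [mul_zero]; exact zero_mem _
      | add_left x y z _ _ _ h1 h2 => rw [add_mul]; exact add_mem h1 h2
      | add_right x y z _ _ _ h1 h2 => rw [mul_add]; exact add_mem h1 h2
      | smul_left r x y _ _ h => rw [smul_mul_assoc]; exact Submodule.smul_mem _ _ h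
      | smul_right r x y _ _ h => rw [mul_smul_comm]; exact Submodule.smul_mem _ _ h)
    ).topologicalClosure

lemma isClosed_modeAlg (k : ℝ) : IsClosed (modeAlg k : Set (ℝ × ℝ →ᵇ ℝ)) :=
  Subalgebra.isClosed_topologicalClosure _

lemma modeB_mem_modeAlg (k : ℝ) (m n : ℤ) : modeB k m n ∈ modeAlg k :=
  Subalgebra.le_topologicalClosure _ (Submodule.subset_span ⟨(m, n), rfl⟩)

/-- The closed span of the modes in `L²`. -/
noncomputable def modeSpan (k : ℝ) : Submodule ℝ (L2per k) :=
  (Submodule.span ℝ (range fun q : ℤ × ℤ => toL2 k (modeB k q.1 q.2))).topologicalClosure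

lemma toL2_modeB_mem_modeSpan (k : ℝ) (m n : ℤ) : toL2 k (modeB k m n) ∈ modeSpan k :=
  Submodule.le_topologicalClosure _ (Submodule.subset_span ⟨(m, n), rfl⟩)

lemma toL2_mem_modeSpan {k : ℝ} {u : ℝ × ℝ →ᵇ ℝ} (hu : u ∈ modeAlg k) : toL2 k u ∈ modeSpan k := by
  have hc : IsClosed {u : ℝ × ℝ →ᵇ ℝ | toL2 k u ∈ modeSpan k} :=
    (Submodule.isClosed_topologicalClosure _).preimage (toL2 k).continuous
  refine closure_minimal (fun w hw => ?_) hc hu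
  have hle : Submodule.span ℝ (range fun q : ℤ × ℤ => modeB k q.1 q.2)
      ≤ (modeSpan k).comap (toL2 k).toLinearMap :=
    Submodule.span_le.2 (by rintro _ ⟨q, rfl⟩; exact toL2_modeB_mem_modeSpan k _ _)
  exact hle hw

/-- An element of the closed span orthogonal to its generators is orthogonal to itself. This
replaces completeness of the modes among symmetric functions. -/
lemma eq_zero_of_mem_modeSpan {k : ℝ} {x : L2per k} (hx : x ∈ modeSpan k)
    (h : ∀ i j : ℕ, j ≤ i → inner ℝ (toL2 k (modeB k i j)) x = 0) : x = 0 := by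
  have hc : IsClosed {y : L2per k | inner ℝ y x = 0} :=
    isClosed_eq (continuous_id.inner continuous_const) continuous_const
  have hx' : x ∈ {y : L2per k | inner ℝ y x = 0} := by
    refine closure_minimal (fun y hy => ?_) hc hx
    change inner ℝ y x = 0
    induction hy using Submodule.span_induction with
    | mem y hy =>
      obtain ⟨⟨m, n⟩, rfl⟩ := hy
      obtain ⟨i, j, hij, he⟩ := exists_nat_mode_eq k m n
      have : modeB k m n = modeB k i j := by ext p; exact congrFun he p
      beta_reduce
      rw [this]
      exact h i j hij
    | zero => exact inner_zero_left _
    | add y z _ _ h1 h2 => rw [inner_add_left, h1, h2, add_zero]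
    | smul r y _ h1 => rw [real_inner_smul_left, h1, mul_zero]
  exact inner_self_eq_zero.1 hx'

/-- The indices of the modes other than the constant and the kernel element. -/
abbrev Idx : Type := {q : ℕ × ℕ // q.2 ≤ q.1 ∧ 2 ≤ q.1 ^ 2 + q.2 ^ 2}

/-- The mode belonging to an index. -/
noncomputable def modeI (k : ℝ) (i : Idx) : ℝ × ℝ →ᵇ ℝ := modeB k i.1.1 i.1.2

/-- The eigenvalue of `Δ + k²` for the mode of index `i`. -/
noncomputable def eig (k : ℝ) (i : Idx) : ℝ := k ^ 2 * (1 - ((i.1.1 : ℝ) ^ 2 + (i.1.2 : ℝ) ^ 2))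

lemma two_le_idx (i : Idx) : (2 : ℝ) ≤ (i.1.1 : ℝ) ^ 2 + (i.1.2 : ℝ) ^ 2 := by
  exact_mod_cast i.2.2

lemma eig_neg {k : ℝ} (hk : 0 < k) (i : Idx) : eig k i < 0 :=
  mul_neg_of_pos_of_neg (by positivity) (by linarith [two_le_idx i])

/-- The coefficient `1 / (λᵢ ‖φᵢ‖)` of the solution operator. -/
noncomputable def solCoeff (k : ℝ) (i : Idx) : ℝ := (eig k i * ‖toL2 k (modeI k i)‖)⁻¹

lemma norm_modeI_pos {k : ℝ} (hk : 0 < k) (i : Idx) : 0 < ‖toL2 k (modeI k i)‖ :=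
  (by positivity : 0 < Real.pi / k).trans_le (norm_toL2_modeB_ge hk _ _)

lemma solCoeff_ne_zero {k : ℝ} (hk : 0 < k) (i : Idx) : solCoeff k i ≠ 0 :=
  inv_ne_zero (mul_ne_zero (eig_neg hk i).ne (norm_modeI_pos hk i).ne')

/-- With `q = m² + n² ≥ 2` one has `q - 1 ≥ (1 + q)/3`, which is where the factor `3` comes from. -/
lemma abs_solCoeff_le {k : ℝ} (hk : 0 < k) (i : Idx) :
    |solCoeff k i| ≤ 3 / (k * Real.pi) * (1 + ((i.1.1 : ℝ) ^ 2 + (i.1.2 : ℝ) ^ 2))⁻¹ := by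
  have h2 := two_le_idx i
  have hn := norm_toL2_modeB_ge hk i.1.1 i.1.2
  set q : ℝ := (i.1.1 : ℝ) ^ 2 + (i.1.2 : ℝ) ^ 2 with hq
  have he : |eig k i| = k ^ 2 * (q - 1) := by
    rw [abs_of_neg (eig_neg hk i), eig]; ring
  rw [solCoeff, abs_inv, abs_mul, he, abs_of_pos (norm_modeI_pos hk i)]
  have hpos : 0 < k * Real.pi / 3 * (1 + q) := by positivity
  have : k * Real.pi / 3 * (1 + q) ≤ k ^ 2 * (q - 1) * ‖toL2 k (modeI k i)‖ := by
    calc k * Real.pi / 3 * (1 + q) ≤ k ^ 2 * (q - 1) * (Real.pi / k) := by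
          rw [show k ^ 2 * (q - 1) * (Real.pi / k) = k * Real.pi * (q - 1) by field_simp]
          have : 0 < k * Real.pi := by positivity
          nlinarith
      _ ≤ _ := by
          refine mul_le_mul_of_nonneg_left hn ?_
          have : 0 ≤ q - 1 := by linarith
          positivity
  calc (k ^ 2 * (q - 1) * ‖toL2 k (modeI k i)‖)⁻¹ ≤ (k * Real.pi / 3 * (1 + q))⁻¹ :=
        inv_anti₀ hpos this
    _ = _ := by rw [mul_inv, inv_div]

/-- This is the embedding of `H²` into continuous functions in dimension two: `(1 + m² + n²)² ≥ (1 +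
m²)(1 + n²)` bounds the squares by a product of two convergent series. -/
lemma summable_solCoeff {k : ℝ} (hk : 0 < k) :
    Summable fun i : Idx => ‖solCoeff k i • modeI k i‖ ^ 2 := by
  have hs : Summable fun n : ℕ => (1 + (n : ℝ) ^ 2)⁻¹ := by
    refine Summable.of_norm_bounded_eventually_nat (Real.summable_nat_pow_inv.2 one_lt_two) ?_
    filter_upwards [eventually_gt_atTop 0] with n hn
    have : (0 : ℝ) < n := by exact_mod_cast hn
    rw [Real.norm_of_nonneg (by positivity)]
    exact inv_anti₀ (by positivity) (by linarith)
  have hp := (hs.mul_of_nonneg hs (fun n => by positivity) fun n => by positivity).mul_left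
    ((2 * (3 / (k * Real.pi))) ^ 2)
  refine Summable.of_nonneg_of_le (fun i => by positivity) (fun i => ?_)
    (hp.comp_injective (Subtype.val_injective
      (p := fun q : ℕ × ℕ => q.2 ≤ q.1 ∧ 2 ≤ q.1 ^ 2 + q.2 ^ 2)))
  set q : ℝ := (i.1.1 : ℝ) ^ 2 + (i.1.2 : ℝ) ^ 2 with hq
  have h1 : ‖solCoeff k i • modeI k i‖ ≤ 2 * (3 / (k * Real.pi)) * (1 + q)⁻¹ := by
    rw [norm_smul, Real.norm_eq_abs]
    calc _ ≤ 3 / (k * Real.pi) * (1 + q)⁻¹ * 2 := by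
          gcongr
          · exact abs_solCoeff_le hk i
          · exact norm_modeB_le _ _ _
      _ = _ := by ring
  calc _ ≤ (2 * (3 / (k * Real.pi)) * (1 + q)⁻¹) ^ 2 := by gcongr
    _ = (2 * (3 / (k * Real.pi))) ^ 2 * ((1 + q) ^ 2)⁻¹ := by rw [mul_pow, inv_pow]
    _ ≤ _ := by
      simp only [Function.comp_apply]
      rw [← mul_inv]
      gcongr
      rw [hq]
      nlinarith [sq_nonneg (i.1.1 : ℝ), sq_nonneg (i.1.2 : ℝ),
        mul_nonneg (sq_nonneg (i.1.1 : ℝ)) (sq_nonneg (i.1.2 : ℝ)),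
        sq_nonneg ((i.1.1 : ℝ) ^ 2), sq_nonneg ((i.1.2 : ℝ) ^ 2)]

lemma norm_solCoeff_smul_modeJet_le {k : ℝ} (hk : 0 < k) :
    ∃ C, ∀ i : Idx, ‖solCoeff k i • modeJet k i.1.1 i.1.2‖ ≤ C := by
  obtain ⟨C, hC, h⟩ := norm_modeJet_le k
  refine ⟨3 / (k * Real.pi) * (C * (1 + k ^ 2)), fun i => ?_⟩
  have h1 := h i.1.1 i.1.2
  simp only [Int.cast_natCast] at h1
  set q : ℝ := (i.1.1 : ℝ) ^ 2 + (i.1.2 : ℝ) ^ 2 with hq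
  have hq0 : 0 ≤ q := by positivity
  rw [norm_smul, Real.norm_eq_abs]
  calc _ ≤ (3 / (k * Real.pi) * (1 + q)⁻¹) * (C * ((1 + k ^ 2) * (1 + q))) := by
        gcongr
        · exact abs_solCoeff_le hk i
        · refine h1.trans ?_
          gcongr
          nlinarith [sq_nonneg k]
    _ = _ := by field_simp

lemma idx_pair_ne {i j : Idx} (h : i ≠ j) : (i.1.1, i.1.2) ≠ (j.1.1, j.1.2) :=
  fun hc => h (Subtype.ext hc)

lemma inner_modeI_of_ne {k : ℝ} (hk : 0 < k) {i j : Idx} (h : i ≠ j) :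
    inner ℝ (toL2 k (modeI k i)) (toL2 k (modeI k j)) = 0 :=
  inner_modeB_of_ne hk i.2.1 j.2.1 (idx_pair_ne h)

lemma inner_modeJet_of_ne {k : ℝ} (hk : 0 < k) {i j : Idx} (h : i ≠ j) :
    inner ℝ (modeJet k i.1.1 i.1.2) (modeJet k j.1.1 j.1.2) = 0 := by
  rw [inner_modeJet]
  exact Finset.sum_eq_zero fun α _ =>
    integral_mode_mul_mode_of_ne hk i.2.1 j.2.1 (idx_pair_ne h) _ _

end Operators

/-! ### Construction of the solution operators `W`, `S`, `T`. -/

section Solution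

open scoped lp ENNReal BoundedContinuousFunction

/-- The inverse of `Δ + k²` on the span of the modes other than the constant and the kernel
element, as an operator `S` into the bounded continuous functions and `T` into `𝒳`; `W` is the
embedding into `L²`. -/
structure IsSolutionOperator {k : ℝ} (W : ℓ²(Idx, ℝ) →ₗᵢ[ℝ] L2per k)
    (S : ℓ²(Idx, ℝ) →L[ℝ] (ℝ × ℝ →ᵇ ℝ)) (T : ℓ²(Idx, ℝ) →L[ℝ] X k) : Prop where
  W_single : ∀ i, W (lp.single 2 i (1 : ℝ)) = ‖toL2 k (modeI k i)‖⁻¹ • toL2 k (modeI k i)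
  S_single : ∀ i, S (lp.single 2 i (1 : ℝ)) = solCoeff k i • modeI k i
  fn_T : ∀ z, fn (T z) = toL2 k (S z)
  lap_T : ∀ z, lap (T z) + k ^ 2 • fn (T z) = W z

/-- `W` is the isometry onto normalised modes; `S` and the jet operator `J` send the same basis
vectors to modes, or their jets, divided by eigenvalue and norm. All defining conditions of `𝒳` are
equalities of continuous linear maps and hence hold once they hold for modes. -/
theorem exists_solutionOperator {k : ℝ} (hk : 0 < k) :
    ∃ (W : ℓ²(Idx, ℝ) →ₗᵢ[ℝ] L2per k) (S : ℓ²(Idx, ℝ) →L[ℝ] (ℝ × ℝ →ᵇ ℝ))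
      (T : ℓ²(Idx, ℝ) →L[ℝ] X k), IsSolutionOperator W S T := by
  have hon : Orthonormal ℝ fun i : Idx => ‖toL2 k (modeI k i)‖⁻¹ • toL2 k (modeI k i) := by
    refine ⟨fun i => ?_, fun i j hij => ?_⟩
    · rw [norm_smul, norm_inv, norm_norm, inv_mul_cancel₀ (norm_modeI_pos hk i).ne']
    · beta_reduce
      rw [real_inner_smul_left, real_inner_smul_right, inner_modeI_of_ne hk hij, mul_zero, mul_zero]
  obtain ⟨W, hW⟩ := exists_clm_of_orthonormal hon
  obtain ⟨S, hS⟩ := exists_clm_of_summable_sq (summable_solCoeff hk)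
  obtain ⟨C, hC⟩ := norm_solCoeff_smul_modeJet_le hk
  obtain ⟨J, hJ⟩ := exists_clm_of_orthogonal
    (x := fun i : Idx => solCoeff k i • modeJet k i.1.1 i.1.2)
    (fun i j hij => by
      beta_reduce
      rw [real_inner_smul_left, real_inner_smul_right, inner_modeJet_of_ne hk hij, mul_zero,
        mul_zero])
    (fun i => smul_ne_zero (solCoeff_ne_zero hk i) (modeJet_ne_zero hk _ _)) hC
  have hJα : ∀ (i : Idx) (α : MultiIdx),
      J (lp.single 2 i (1 : ℝ)) α = solCoeff k i • modeJet k i.1.1 i.1.2 α := fun i α => by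
    rw [hJ, PiLp.smul_apply]
  have hfn : ∀ z, J z idx0 = toL2 k (S z) := by
    have : (PiLp.proj 2 (fun _ : MultiIdx => L2per k) idx0 : JetSpace k →L[ℝ] L2per k).comp J
        = (toL2 k).comp S := by
      refine clm_lp_ext fun i => ?_
      rw [ContinuousLinearMap.comp_apply, ContinuousLinearMap.comp_apply, hS, map_smul,
        PiLp.proj_apply, hJα, modeJet_idx0]
      rfl
    exact fun z => DFunLike.congr_fun this z
  have hweak : ∀ z α, IsWeakDeriv k α (J z idx0) (J z α) := by
    intro z α φ hφ hφp
    rw [integral_mul_eq_inner k _ (contDiff_classicalDeriv α hφ).continuous,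
      integral_mul_eq_inner k _ hφ.continuous]
    set a := (memLp_of_continuous k (contDiff_classicalDeriv α hφ).continuous).toLp with ha
    set b := (memLp_of_continuous k hφ.continuous).toLp with hb
    -- For a fixed test function, both sides of the weak derivative identity are `L²` inner products
    -- with a fixed element, thus continuous in `z`.
    have : (innerSL ℝ a).comp ((PiLp.proj 2 (fun _ : MultiIdx => L2per k) idx0 :
          JetSpace k →L[ℝ] L2per k).comp J)
        = ((-1 : ℝ) ^ ((α.1.1 : ℕ) + (α.1.2 : ℕ))) • (innerSL ℝ b).comp
          ((PiLp.proj 2 (fun _ : MultiIdx => L2per k) α : JetSpace k →L[ℝ] L2per k).comp J) := by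
      refine clm_lp_ext fun i => ?_
      have h := (isWeakDeriv_modeJet hk i.1.1 i.1.2 α).smul (solCoeff k i) φ hφ hφp
      rw [integral_mul_eq_inner k _ (contDiff_classicalDeriv α hφ).continuous,
        integral_mul_eq_inner k _ hφ.continuous, ← hJα, ← hJα] at h
      exact h
    exact DFunLike.congr_fun this z
  have hsym : ∀ z, SquareSymmetric k (J z idx0) := by
    intro z G hG
    have hpt : ∀ p, S z (G p) = S z p := by
      intro p
      have : (BoundedContinuousFunction.evalCLM ℝ (G p)).comp S
          = (BoundedContinuousFunction.evalCLM ℝ p).comp S := by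
        refine clm_lp_ext fun i => ?_
        rw [ContinuousLinearMap.comp_apply, ContinuousLinearMap.comp_apply, hS, map_smul, map_smul]
        exact congrArg _ (mode_squareGroup k _ _ hG p)
      exact DFunLike.congr_fun this z
    rw [hfn]
    have h0 := coeFn_toL2 k (S z)
    have h' := (measurePreserving_of_mem_squareGroup k hG).quasiMeasurePreserving.ae h0
    filter_upwards [h0, h'] with p h1 h2
    rw [h1, h2, hpt]
  have hmean : ∀ z, ⨍ p, (J z idx0) p ∂(cellMeasure k) = 0 := by
    intro z
    have h1 : ∫ p, (J z idx0) p ∂(cellMeasure k)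
        = (1 / 2) * inner ℝ (toL2 k (modeB k (0 : ℕ) (0 : ℕ))) (J z idx0) := by
      rw [inner_eq_integral k (coeFn_toL2 k _) (ae_eq_refl _), ← integral_const_mul]
      refine integral_congr_ae (Eventually.of_forall fun p => ?_)
      simp only [modeB_apply, mode_zero]
      norm_num
      ring
    have : ((innerSL ℝ (toL2 k (modeB k (0 : ℕ) (0 : ℕ)))).comp (toL2 k)).comp S = 0 := by
      refine clm_lp_ext fun i => ?_
      rw [ContinuousLinearMap.comp_apply, hS, map_smul, ContinuousLinearMap.comp_apply,
        innerSL_apply_apply, modeI, inner_modeB_of_ne hk le_rfl i.2.1, smul_zero]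
      · rfl
      · intro h
        have := i.2.2
        rw [Prod.mk.injEq] at h
        rw [← h.1, ← h.2] at this
        omega
    have h2 := DFunLike.congr_fun this z
    rw [average_eq, h1, hfn]
    rw [ContinuousLinearMap.comp_apply, ContinuousLinearMap.comp_apply, innerSL_apply_apply] at h2
    rw [h2]
    simp
  refine ⟨W, S, J.codRestrict (X k) fun z => ⟨hweak z, hsym z, hmean z⟩, hW, hS, hfn, ?_⟩
  -- On a mode, `Δ + k²` produces the factor `eig k i`, which cancels the one in `solCoeff` and
  -- leaves the normalised mode.
  have : (PiLp.proj 2 (fun _ : MultiIdx => L2per k) idxXX : JetSpace k →L[ℝ] L2per k).comp J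
      + (PiLp.proj 2 (fun _ : MultiIdx => L2per k) idxYY : JetSpace k →L[ℝ] L2per k).comp J
      + k ^ 2 • (PiLp.proj 2 (fun _ : MultiIdx => L2per k) idx0 : JetSpace k →L[ℝ] L2per k).comp J
      = W.toContinuousLinearMap := by
    refine clm_lp_ext fun i => ?_
    change J (lp.single 2 i (1 : ℝ)) idxXX + J (lp.single 2 i (1 : ℝ)) idxYY
      + k ^ 2 • J (lp.single 2 i (1 : ℝ)) idx0 = W (lp.single 2 i (1 : ℝ))
    rw [hW, hJα, hJα, hJα, ← smul_add, modeJet_laplacian, modeJet_idx0, smul_smul, smul_smul,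
      ← add_smul, modeI]
    congr 1
    rw [solCoeff, modeI, mul_inv]
    have := (eig_neg hk i).ne
    simp only [Int.cast_natCast]
    rw [show (eig k i)⁻¹ * ‖toL2 k (modeB k i.1.1 i.1.2)‖⁻¹
          * -(k ^ 2 * ((i.1.1 : ℝ) ^ 2 + (i.1.2 : ℝ) ^ 2))
        + k ^ 2 * ((eig k i)⁻¹ * ‖toL2 k (modeB k i.1.1 i.1.2)‖⁻¹)
        = (eig k i)⁻¹ * eig k i * ‖toL2 k (modeB k i.1.1 i.1.2)‖⁻¹ by rw [eig]; ring,
      inv_mul_cancel₀ this, one_mul]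
  exact fun z => DFunLike.congr_fun this z

namespace IsSolutionOperator

variable {k : ℝ} {W : ℓ²(Idx, ℝ) →ₗᵢ[ℝ] L2per k} {S : ℓ²(Idx, ℝ) →L[ℝ] (ℝ × ℝ →ᵇ ℝ)}
  {T : ℓ²(Idx, ℝ) →L[ℝ] X k}

lemma S_mem (h : IsSolutionOperator W S T) (z : ℓ²(Idx, ℝ)) : S z ∈ modeAlg k := by
  refine clm_lp_mem S (V := Subalgebra.toSubmodule (modeAlg k)) (isClosed_modeAlg k) (fun i => ?_) z
  rw [h.S_single]
  exact Submodule.smul_mem _ _ (modeB_mem_modeAlg k _ _)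

lemma W_mem (h : IsSolutionOperator W S T) (z : ℓ²(Idx, ℝ)) : W z ∈ modeSpan k := by
  refine clm_lp_mem W.toContinuousLinearMap (Submodule.isClosed_topologicalClosure _)
    (fun i => ?_) z
  rw [LinearIsometry.coe_toContinuousLinearMap, h.W_single]
  exact Submodule.smul_mem _ _ (toL2_modeB_mem_modeSpan k _ _)

lemma S_periodic (h : IsSolutionOperator W S T) (hk : 0 < k) (z : ℓ²(Idx, ℝ)) :
    SquarePeriodic k (S z) := by
  have key : ∀ p q : ℝ × ℝ, (∀ m n : ℤ, mode k m n 0 0 p = mode k m n 0 0 q) → S z p = S z q := by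
    intro p q hpq
    have : (BoundedContinuousFunction.evalCLM ℝ p).comp S
        = (BoundedContinuousFunction.evalCLM ℝ q).comp S := by
      refine clm_lp_ext fun i => ?_
      rw [ContinuousLinearMap.comp_apply, ContinuousLinearMap.comp_apply, h.S_single, map_smul,
        map_smul]
      exact congrArg _ (hpq _ _)
    exact DFunLike.congr_fun this z
  exact fun p => ⟨key _ _ fun m n => (periodic_mode hk m n p).1,
    key _ _ fun m n => (periodic_mode hk m n p).2⟩

/-- The two inequalities single out `(0,0)` and `(1,0)`, the constant and the kernel mode, which are
absent from `Idx`. -/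
lemma inner_W_eq_zero (h : IsSolutionOperator W S T) (hk : 0 < k) {a b : ℕ}
    (hab : b ≤ a) (h2 : a ^ 2 + b ^ 2 < 2) (z : ℓ²(Idx, ℝ)) :
    inner ℝ (toL2 k (modeB k a b)) (W z) = 0 := by
  have : (innerSL ℝ (toL2 k (modeB k a b))).comp W.toContinuousLinearMap = 0 := by
    refine clm_lp_ext fun i => ?_
    rw [ContinuousLinearMap.comp_apply, LinearIsometry.coe_toContinuousLinearMap, h.W_single,
      map_smul, innerSL_apply_apply, modeI, inner_modeB_of_ne hk hab i.2.1, smul_zero]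
    · rfl
    · intro hc
      have := i.2.2
      rw [Prod.mk.injEq] at hc
      rw [← hc.1, ← hc.2] at this
      omega
  exact DFunLike.congr_fun this z

lemma inner_S_eq_zero (h : IsSolutionOperator W S T) (hk : 0 < k) {a b : ℕ}
    (hab : b ≤ a) (h2 : a ^ 2 + b ^ 2 < 2) (z : ℓ²(Idx, ℝ)) :
    inner ℝ (toL2 k (modeB k a b)) (toL2 k (S z)) = 0 := by
  have : ((innerSL ℝ (toL2 k (modeB k a b))).comp (toL2 k)).comp S = 0 := by
    refine clm_lp_ext fun i => ?_
    rw [ContinuousLinearMap.comp_apply, h.S_single,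
      map_smul, ContinuousLinearMap.comp_apply, innerSL_apply_apply, modeI,
      inner_modeB_of_ne hk hab i.2.1, smul_zero]
    · rfl
    · intro hc
      have := i.2.2
      rw [Prod.mk.injEq] at hc
      rw [← hc.1, ← hc.2] at this
      omega
  exact DFunLike.congr_fun this z

end IsSolutionOperator

end Solution

/-! ### The kernel element in terms of modes: its square and its norm. -/

section Kernel

open scoped lp ENNReal BoundedContinuousFunction

lemma xiFun_eq (k : ℝ) : xiFun k = fun p => 2 * mode k 1 0 0 0 p := by
  funext p
  simp [xiFun, mode_zero]
  ring

lemma pderivX_const_mul (c : ℝ) (f : ℝ × ℝ → ℝ) :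
    pderivX (fun p => c * f p) = fun p => c * pderivX f p := by
  funext p
  exact deriv_const_mul_field c

lemma pderivY_const_mul (c : ℝ) (f : ℝ × ℝ → ℝ) :
    pderivY (fun p => c * f p) = fun p => c * pderivY f p := by
  funext p
  exact deriv_const_mul_field c

lemma xiDeriv_eq (k : ℝ) (α : MultiIdx) :
    xiDeriv k α = fun p => 2 * mode k 1 0 α.1.1 α.1.2 p := by
  have hX : ∀ (a : ℕ) (f : ℝ × ℝ → ℝ),
      pderivX^[a] (fun p => 2 * f p) = fun p => 2 * pderivX^[a] f p := fun a => by
    induction a with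
    | zero => exact fun _ => rfl
    | succ a ih =>
      intro f
      rw [Function.iterate_succ_apply, Function.iterate_succ_apply, pderivX_const_mul, ih]
  have hY : ∀ (a : ℕ) (f : ℝ × ℝ → ℝ),
      pderivY^[a] (fun p => 2 * f p) = fun p => 2 * pderivY^[a] f p := fun a => by
    induction a with
    | zero => exact fun _ => rfl
    | succ a ih =>
      intro f
      rw [Function.iterate_succ_apply, Function.iterate_succ_apply, pderivY_const_mul, ih]
  rw [xiDeriv, xiFun_eq, hX, hY, iterate_pderiv_mode]

lemma xiJet_eq {k : ℝ} (hk : 0 < k) : xiJet hk = (2 : ℝ) • modeJet k 1 0 := by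
  refine PiLp.ext fun α => Lp.ext ?_
  have h1 : xiJet hk α =ᵐ[cellMeasure k] xiDeriv k α :=
    MemLp.coeFn_toLp (memLp_of_continuous k (contDiff_xiDeriv hk α).continuous)
  rw [PiLp.smul_apply]
  filter_upwards [h1, Lp.coeFn_smul (2 : ℝ) (modeJet k 1 0 α), coeFn_modeJet k 1 0 α]
    with p h1 h2 h3
  rw [h1, h2, Pi.smul_apply, h3, xiDeriv_eq, smul_eq_mul]

/-- The kernel element as a bounded continuous function. -/
noncomputable def xiB (k : ℝ) : ℝ × ℝ →ᵇ ℝ := (2 : ℝ) • modeB k 1 0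

lemma fn_xi {k : ℝ} (hk : 0 < k) : fn (xi hk) = toL2 k (xiB k) := by
  change xiJet hk idx0 = _
  rw [xiJet_eq, PiLp.smul_apply, modeJet_idx0, xiB, map_smul]

lemma lap_xi {k : ℝ} (hk : 0 < k) : lap (xi hk) + k ^ 2 • fn (xi hk) = 0 := by
  change xiJet hk idxXX + xiJet hk idxYY + k ^ 2 • xiJet hk idx0 = 0
  rw [xiJet_eq, PiLp.smul_apply, PiLp.smul_apply, PiLp.smul_apply, ← smul_add, modeJet_laplacian,
    modeJet_idx0, smul_smul, smul_smul, ← add_smul]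
  convert zero_smul ℝ _ using 2
  simp
  ring

lemma xiB_sq (k : ℝ) : xiB k ^ 2 = (2 : ℝ) • modeB k 0 0 + (2 : ℝ) • modeB k 2 0
    + (4 : ℝ) • modeB k 1 1 := by
  ext p
  have h2 : ∀ t : ℝ, Real.cos (k * 2 * t) = 2 * Real.cos (k * t) ^ 2 - 1 := fun t => by
    rw [← Real.cos_two_mul]; ring_nf
  change ((2 : ℝ) * mode k 1 0 0 0 p) ^ 2 = 2 * mode k 0 0 0 0 p + 2 * mode k 2 0 0 0 p
    + 4 * mode k 1 1 0 0 p
  simp only [mode_zero, Int.cast_one, Int.cast_zero, Int.cast_ofNat, h2, mul_one, mul_zero,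
    zero_mul, Real.cos_zero]
  ring

/-- The area of the cell. -/
noncomputable def area (k : ℝ) : ℝ := 4 * Real.pi ^ 2 / k ^ 2

lemma area_pos {k : ℝ} (hk : 0 < k) : 0 < area k := by unfold area; positivity

lemma cosInt_natCast_ne {k : ℝ} (hk : 0 < k) (c : ℝ) :
    cosInt k 1 0 c = 0 ∧ cosInt k 0 1 c = 0 ∧ cosInt k 2 0 c = 0 ∧ cosInt k 0 2 c = 0 := by
  refine ⟨?_, ?_, ?_, ?_⟩
  · exact_mod_cast cosInt_of_ne hk (m := 1) (n := 0) (by norm_num) c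
  · exact_mod_cast cosInt_of_ne hk (m := 0) (n := 1) (by norm_num) c
  · exact_mod_cast cosInt_of_ne hk (m := 2) (n := 0) (by norm_num) c
  · exact_mod_cast cosInt_of_ne hk (m := 0) (n := 2) (by norm_num) c

lemma inner_modeB_self {k : ℝ} (hk : 0 < k) :
    inner ℝ (toL2 k (modeB k 1 0)) (toL2 k (modeB k 1 0)) = area k ∧
    inner ℝ (toL2 k (modeB k 2 0)) (toL2 k (modeB k 2 0)) = area k ∧
    inner ℝ (toL2 k (modeB k 1 1)) (toL2 k (modeB k 1 1)) = area k ∧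
    inner ℝ (toL2 k (modeB k 0 0)) (toL2 k (modeB k 0 0)) = 4 * area k := by
  simp only [inner_modeB, integral_mode_mul_mode, cosInt_natCast_ne hk, cosInt_zero hk,
    cosInt_self hk one_ne_zero, cosInt_self hk two_ne_zero, area]
  refine ⟨?_, ?_, ?_, ?_⟩ <;>
  · simp
    field_simp
    ring

lemma inner_modeB_eq_zero {k : ℝ} (hk : 0 < k) {m n i j : ℤ} (hn : 0 ≤ n) (hmn : n ≤ m)
    (hj : 0 ≤ j) (hij : j ≤ i) (h : (m, n) ≠ (i, j)) :
    inner ℝ (toL2 k (modeB k m n)) (toL2 k (modeB k i j)) = 0 := by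
  lift m to ℕ using hn.trans hmn
  lift n to ℕ using hn
  lift i to ℕ using hj.trans hij
  lift j to ℕ using hj
  exact inner_modeB_of_ne hk (by exact_mod_cast hmn) (by exact_mod_cast hij)
    (by simpa using h)

/-- In `1 + k² + k⁴` the two first derivatives contribute `k²/2` each and the two pure second
derivatives `k⁴/2` each; the mixed derivative vanishes. -/
lemma norm_xi_sq {k : ℝ} (hk : 0 < k) :
    ‖xi hk‖ ^ 2 = 16 * Real.pi ^ 2 * (1 + k ^ 2 + k ^ 4) / k ^ 2 := by
  have h0 : ‖xi hk‖ = ‖xiJet hk‖ := rfl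
  rw [h0, xiJet_eq, norm_smul, mul_pow, ← real_inner_self_eq_norm_sq (modeJet k 1 0),
    inner_modeJet]
  have hu : (Finset.univ : Finset MultiIdx) = {⟨(0, 0), by decide⟩, ⟨(1, 0), by decide⟩,
      ⟨(0, 1), by decide⟩, ⟨(2, 0), by decide⟩, ⟨(1, 1), by decide⟩, ⟨(0, 2), by decide⟩} := by
    decide
  rw [hu]
  repeat rw [Finset.sum_insert (by decide)]
  rw [Finset.sum_singleton]
  simp only [integral_mode_mul_mode, cosInt_natCast_ne hk, cosInt_zero hk,
    cosInt_self hk one_ne_zero]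
  simp
  field_simp
  ring

end Kernel

/-! ### The reduced equation and the value of its leading coefficient. -/

section Reduction

open scoped lp ENNReal BoundedContinuousFunction

lemma modeB_zero_zero (k : ℝ) : modeB k 0 0 = (2 : ℝ) • (1 : ℝ × ℝ →ᵇ ℝ) := by
  ext p
  simp [modeB_apply, mode_zero]
  norm_num

/-- The index of the mode `cos (2 k x) + cos (2 k y)`. -/
def idxTwoZero : Idx := ⟨(2, 0), by norm_num, by norm_num⟩

/-- The index of the mode `2 cos (k x) cos (k y)`. -/
def idxOneOne : Idx := ⟨(1, 1), by norm_num, by norm_num⟩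

/-- The functional `u ↦ ∫ ξ₀ u`. -/
noncomputable def kerFun (k : ℝ) : (ℝ × ℝ →ᵇ ℝ) →L[ℝ] ℝ :=
  (innerSL ℝ (toL2 k (xiB k))).comp (toL2 k)

lemma kerFun_apply (k : ℝ) (u : ℝ × ℝ →ᵇ ℝ) :
    kerFun k u = inner ℝ (toL2 k (xiB k)) (toL2 k u) := rfl

lemma kerFun_eq (k : ℝ) (u : ℝ × ℝ →ᵇ ℝ) :
    kerFun k u = 2 * inner ℝ (toL2 k (modeB k (1 : ℕ) (0 : ℕ))) (toL2 k u) := by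
  rw [kerFun_apply, xiB, map_smul, real_inner_smul_left]
  rfl

/-- Moving one factor `ξ₀` across the inner product turns the cubic quantities in the formula for `m
0` into pairings with the three modes of `ξ₀²`. -/
lemma kerFun_mul (k : ℝ) (u : ℝ × ℝ →ᵇ ℝ) :
    kerFun k (xiB k * u) = inner ℝ (toL2 k (xiB k ^ 2)) (toL2 k u) := by
  rw [kerFun_apply, inner_toL2, inner_toL2]
  refine integral_congr_ae (Eventually.of_forall fun p => ?_)
  change xiB k p * (xiB k p * u p) = xiB k p ^ 2 * u p
  ring

lemma kerFun_xiB {k : ℝ} (hk : 0 < k) : kerFun k (xiB k) = 4 * area k := by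
  rw [kerFun_apply, xiB, map_smul, real_inner_smul_left, real_inner_smul_right,
    (inner_modeB_self hk).1]
  ring

/-- `ξ₀²` contains only the modes `(0,0)`, `(2,0)`, `(1,1)`. This absence of quadratic resonance
makes the bifurcation a pitchfork. -/
lemma kerFun_xiB_sq {k : ℝ} (hk : 0 < k) : kerFun k (xiB k ^ 2) = 0 := by
  rw [kerFun_apply, xiB_sq, xiB]
  simp only [map_add, map_smul, inner_add_right, real_inner_smul_left, real_inner_smul_right]
  rw [inner_modeB_eq_zero hk le_rfl zero_le_one le_rfl le_rfl (by decide),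
    inner_modeB_eq_zero hk le_rfl zero_le_one le_rfl zero_le_two (by decide),
    inner_modeB_eq_zero hk le_rfl zero_le_one zero_le_one le_rfl (by decide)]
  ring

/-- Inner products of linear combinations of the modes occurring in `ξ₀²`. -/
lemma inner_xiB_sq {k : ℝ} (hk : 0 < k) (a b c : ℝ) :
    inner ℝ (toL2 k (xiB k ^ 2)) (toL2 k (a • modeB k 0 0 + b • modeB k 2 0 + c • modeB k 1 1))
      = (8 * a + 2 * b + 4 * c) * area k := by
  obtain ⟨-, h20, h11, h00⟩ := inner_modeB_self hk
  have e1 := inner_modeB_eq_zero hk (m := 0) (i := 2) le_rfl le_rfl le_rfl zero_le_two (by decide)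
  have e2 := inner_modeB_eq_zero hk (m := 0) (i := 1) le_rfl le_rfl zero_le_one le_rfl (by decide)
  have e3 := inner_modeB_eq_zero hk (m := 2) (i := 1) le_rfl zero_le_two zero_le_one le_rfl
    (by decide)
  rw [xiB_sq]
  simp only [map_add, map_smul, inner_add_right, inner_add_left, real_inner_smul_left,
    real_inner_smul_right]
  rw [h20, h11, h00, e1, e2, e3, real_inner_comm, e1, real_inner_comm, e2, real_inner_comm, e3]
  ring

/-- The `L²`-coefficients of a function. -/
noncomputable def coeffs {k : ℝ} (W : ℓ²(Idx, ℝ) →ₗᵢ[ℝ] L2per k) :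
    (ℝ × ℝ →ᵇ ℝ) →L[ℝ] ℓ²(Idx, ℝ) :=
  (ContinuousLinearMap.adjoint W.toContinuousLinearMap).comp (toL2 k)

namespace IsSolutionOperator

variable {k : ℝ} {W : ℓ²(Idx, ℝ) →ₗᵢ[ℝ] L2per k} {S : ℓ²(Idx, ℝ) →L[ℝ] (ℝ × ℝ →ᵇ ℝ)}
  {T : ℓ²(Idx, ℝ) →L[ℝ] X k}

lemma coeffs_apply (h : IsSolutionOperator W S T) (u : ℝ × ℝ →ᵇ ℝ) (i : Idx) :
    coeffs W u i = ‖toL2 k (modeI k i)‖⁻¹ * inner ℝ (toL2 k (modeI k i)) (toL2 k u) := by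
  have h1 : coeffs W u i = inner ℝ (lp.single 2 i (1 : ℝ) : ℓ²(Idx, ℝ)) (coeffs W u) := by
    rw [lp.inner_single_left]
    simp
  rw [h1, coeffs, ContinuousLinearMap.comp_apply, ContinuousLinearMap.adjoint_inner_right,
    LinearIsometry.coe_toContinuousLinearMap, h.W_single, real_inner_smul_left]

lemma inner_modeI_W (h : IsSolutionOperator W S T) (hk : 0 < k) (z : ℓ²(Idx, ℝ)) (i : Idx) :
    inner ℝ (toL2 k (modeI k i)) (W z) = ‖toL2 k (modeI k i)‖ * z i := by
  have h1 : toL2 k (modeI k i) = ‖toL2 k (modeI k i)‖ • W (lp.single 2 i (1 : ℝ)) := by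
    rw [h.W_single, smul_smul, mul_inv_cancel₀ (norm_modeI_pos hk i).ne', one_smul]
  conv_lhs => rw [h1]
  rw [real_inner_smul_left, LinearIsometry.inner_map_map, lp.inner_single_left]
  simp

lemma inner_modeI (h : IsSolutionOperator W S T) (hk : 0 < k) (u : ℝ × ℝ →ᵇ ℝ) (i : Idx) :
    inner ℝ (toL2 k (modeI k i)) (toL2 k u) = ‖toL2 k (modeI k i)‖ * coeffs W u i := by
  rw [h.coeffs_apply, ← mul_assoc, mul_inv_cancel₀ (norm_modeI_pos hk i).ne', one_mul]

lemma coeffs_modeB_eq_zero (h : IsSolutionOperator W S T) (hk : 0 < k) {a b : ℕ} (hab : b ≤ a)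
    (h2 : a ^ 2 + b ^ 2 < 2) : coeffs W (modeB k a b) = 0 := by
  ext i
  rw [h.coeffs_apply, modeI, inner_modeB_of_ne hk i.2.1 hab, mul_zero]
  · rfl
  · intro hc
    have := i.2.2
    rw [Prod.mk.injEq] at hc
    rw [hc.1, hc.2] at this
    omega

lemma S_coeffs_modeI (h : IsSolutionOperator W S T) (hk : 0 < k) (i : Idx) :
    S (coeffs W (modeI k i)) = (eig k i)⁻¹ • modeI k i := by
  have h0 := (norm_modeI_pos hk i).ne'
  have : coeffs W (modeI k i) = ‖toL2 k (modeI k i)‖ • lp.single 2 i (1 : ℝ) := by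
    ext j
    rw [h.coeffs_apply, lp.coeFn_smul, Pi.smul_apply, smul_eq_mul]
    by_cases hij : j = i
    · subst hij
      rw [real_inner_self_eq_norm_sq, lp.single_apply_self]
      field_simp
    · rw [inner_modeI_of_ne hk hij, lp.single_apply_ne _ _ _ hij, mul_zero, mul_zero]
  rw [this, map_smul, h.S_single, smul_smul, solCoeff, mul_inv, mul_comm, mul_assoc,
    inv_mul_cancel₀ h0, mul_one]

lemma coeffs_xiB (h : IsSolutionOperator W S T) (hk : 0 < k) : coeffs W (xiB k) = 0 := by
  rw [xiB, map_smul]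
  have := h.coeffs_modeB_eq_zero hk (a := 1) (b := 0) (by simp) (by simp)
  simp only [Nat.cast_one, Nat.cast_zero] at this
  rw [this, smul_zero]

/-- The constant is projected away; the modes `(2,0)` and `(1,1)`, with coefficients `2` and `4`,
are divided by the eigenvalues `-3k²` and `-k²`. The zero term fits the shape of `inner_xiB_sq`. -/
lemma S_coeffs_xiB_sq (h : IsSolutionOperator W S T) (hk : 0 < k) :
    S (coeffs W (xiB k ^ 2)) = (0 : ℝ) • modeB k 0 0 + (-2 / (3 * k ^ 2)) • modeB k 2 0
      + (-4 / k ^ 2) • modeB k 1 1 := by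
  have h0 := h.coeffs_modeB_eq_zero hk (a := 0) (b := 0) (by simp) (by simp)
  have h1 := h.S_coeffs_modeI hk idxTwoZero
  have h2 := h.S_coeffs_modeI hk idxOneOne
  have m1 : modeI k idxTwoZero = modeB k 2 0 := rfl
  have m2 : modeI k idxOneOne = modeB k 1 1 := rfl
  have e1 : eig k idxTwoZero = -3 * k ^ 2 := by simp [eig, idxTwoZero]; ring
  have e2 : eig k idxOneOne = -k ^ 2 := by simp [eig, idxOneOne]
  simp only [Nat.cast_zero] at h0
  rw [m1, e1] at h1
  rw [m2, e2] at h2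
  rw [xiB_sq, map_add, map_add, map_add, map_add, map_smul, map_smul, map_smul, map_smul, map_smul,
    map_smul, h0, h1, h2, map_zero, smul_zero, zero_smul, smul_smul, smul_smul]
  congr 2
  · congr 1
    field_simp
  · field_simp

lemma kerFun_S (h : IsSolutionOperator W S T) (hk : 0 < k) (z : ℓ²(Idx, ℝ)) :
    kerFun k (S z) = 0 := by
  rw [kerFun_eq, h.inner_S_eq_zero hk (by simp) (by simp), mul_zero]

/-- The branch of solutions in the scale of the kernel element `ξ₀`. -/
theorem exists_reduced_branch (h : IsSolutionOperator W S T) (hk : 0 < k) (g : ℝ) :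
    ∃ (z : ℝ → ℓ²(Idx, ℝ)) (m : ℝ → ℝ), ContDiffAt ℝ 1 z 0 ∧ ContDiffAt ℝ 1 m 0 ∧
      m 0 = -((g + k ^ 2) * (104 * g + 203 * k ^ 2) / (3 * k ^ 2)) ∧
      ∀ᶠ t in 𝓝 0, ∀ u, u = t • xiB k + t ^ 2 • S (z t) → ∀ N,
        N = (-1 / 4 : ℝ) • u ^ 2 + (11 / 48 : ℝ) • u ^ 3 + u ^ 4 * remainder u →
        t ^ 2 • z t + (t ^ 2 * m t / 4) • coeffs W u
          + (Mstar g k + t ^ 2 * m t) • coeffs W N = 0 ∧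
        t ^ 2 * m t / 4 * kerFun k u + (Mstar g k + t ^ 2 * m t) * kerFun k N = 0 := by
  have hne : kerFun k (xiB k) ≠ 0 := by
    rw [kerFun_xiB hk]
    have := area_pos hk
    positivity
  obtain ⟨z, m, hz, hm, hm0, he⟩ := exists_branch S (coeffs W) (kerFun k) (xiB k)
    (contDiffAt_remainder (𝒜 := ℝ × ℝ →ᵇ ℝ)) (Mstar g k) (-1 / 4) (11 / 48) (h.coeffs_xiB hk)
    (h.kerFun_S hk) (kerFun_xiB_sq hk) hne
  refine ⟨z, m, hz, hm, ?_, he⟩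
  have hV := area_pos hk
  rw [kerFun_xiB hk, pow_succ' (xiB k) 2, kerFun_mul, kerFun_mul, h.S_coeffs_xiB_sq hk,
    inner_xiB_sq hk] at hm0
  have h3 := inner_xiB_sq hk 2 2 4
  rw [← xiB_sq] at h3
  rw [h3, Mstar] at hm0
  -- The two brackets with weights `8, 2, 4` are the pairings of `ξ₀²` with itself and with `S
  -- (coeffs W (ξ₀²))`, per unit area.
  have hm0' : m 0 = -(4 * g + 4 * k ^ 2) * (11 / 48 * (8 * 2 + 2 * 2 + 4 * 4)
      - 2 * (4 * g + 4 * k ^ 2) * (-1 / 4) ^ 2 *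
      (8 * 0 + 2 * (-2 / (3 * k ^ 2)) + 4 * (-4 / k ^ 2))) := by
    apply mul_right_cancel₀ hV.ne'
    linear_combination hm0
  rw [hm0']
  field_simp
  ring

end IsSolutionOperator

end Reduction

/-! ### From the reduced equations back to `F = 0`. -/

section Branch

open scoped lp ENNReal BoundedContinuousFunction

lemma one_eq_modeB (k : ℝ) : (1 : ℝ × ℝ →ᵇ ℝ) = (1 / 2 : ℝ) • modeB k (0 : ℕ) (0 : ℕ) := by
  rw [Nat.cast_zero, modeB_zero_zero, smul_smul]
  norm_num

lemma inner_one_one {k : ℝ} (hk : 0 < k) :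
    inner ℝ (toL2 k 1) (toL2 k 1) = area k := by
  rw [one_eq_modeB k, map_smul, real_inner_smul_left, real_inner_smul_right, Nat.cast_zero,
    (inner_modeB_self hk).2.2.2]
  ring

lemma inner_one (k : ℝ) (u : ℝ × ℝ →ᵇ ℝ) :
    inner ℝ (toL2 k 1) (toL2 k u) = ∫ p, u p ∂(cellMeasure k) := by
  rw [inner_toL2]
  simp

lemma measureReal_cell {k : ℝ} (hk : 0 < k) : (cellMeasure k).real univ = area k := by
  rw [← inner_one_one hk, inner_one]
  simp

lemma average_eq_inner {k : ℝ} (hk : 0 < k) (u : ℝ × ℝ →ᵇ ℝ) :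
    area k * ⨍ p, u p ∂(cellMeasure k) = inner ℝ (toL2 k 1) (toL2 k u) := by
  rw [average_eq, measureReal_cell hk, inner_one, smul_eq_mul, ← mul_assoc,
    mul_inv_cancel₀ (area_pos hk).ne', one_mul]

lemma xiB_mem_modeAlg (k : ℝ) : xiB k ∈ modeAlg k :=
  Subalgebra.smul_mem _ (modeB_mem_modeAlg k 1 0) _

namespace IsSolutionOperator

variable {k : ℝ} {W : ℓ²(Idx, ℝ) →ₗᵢ[ℝ] L2per k} {S : ℓ²(Idx, ℝ) →L[ℝ] (ℝ × ℝ →ᵇ ℝ)}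
  {T : ℓ²(Idx, ℝ) →L[ℝ] X k}

lemma fn_branch (h : IsSolutionOperator W S T) (hk : 0 < k) (t : ℝ) (z : ℓ²(Idx, ℝ)) :
    fn (t • xi hk + t ^ 2 • T z) = toL2 k (t • xiB k + t ^ 2 • S z) := by
  rw [map_add, map_smul, map_smul, ← fn_xi hk, ← h.fn_T]
  rfl

lemma lap_branch (h : IsSolutionOperator W S T) (hk : 0 < k) (t : ℝ) (z : ℓ²(Idx, ℝ)) :
    lap (t • xi hk + t ^ 2 • T z)
      = t ^ 2 • W z - k ^ 2 • toL2 k (t • xiB k + t ^ 2 • S z) := by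
  have h1 : lap (t • xi hk + t ^ 2 • T z) = t • lap (xi hk) + t ^ 2 • lap (T z) := by
    simp only [lap, Submodule.coe_add, Submodule.coe_smul, PiLp.add_apply, PiLp.smul_apply,
      smul_add]
    abel
  rw [h1, eq_neg_of_add_eq_zero_left (lap_xi hk), eq_sub_of_add_eq (h.lap_T z), map_add, map_smul,
    map_smul, fn_xi hk, h.fn_T]
  module

lemma branch_mem_U (h : IsSolutionOperator W S T) (hk : 0 < k) {t : ℝ} {z : ℓ²(Idx, ℝ)}
    (hu : ‖t • xiB k + t ^ 2 • S z‖ < 1) : t • xi hk + t ^ 2 • T z ∈ U k := by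
  refine ⟨(t • xiB k + t ^ 2 • S z : ℝ × ℝ →ᵇ ℝ), BoundedContinuousFunction.continuous _,
    fun p => ?_, ?_, fun p => ?_⟩
  · have h1 := periodic_mode hk 1 0 p
    have h2 := h.S_periodic hk z p
    have e : ∀ q, (t • xiB k + t ^ 2 • S z) q = t * (2 * mode k 1 0 0 0 q) + t ^ 2 * S z q :=
      fun q => rfl
    rw [e, e, e, h1.1, h1.2, h2.1, h2.2]
    exact ⟨rfl, rfl⟩
  · rw [h.fn_branch hk]
    exact (coeFn_toL2 k _).symm
  · have := (BoundedContinuousFunction.norm_coe_le_norm _ p).trans_lt hu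
    exact (abs_lt.1 this).1

/-- `F` lies in the closed span of the modes and is tested against each of them: modes in `Idx` see
the range equation, `(1,0)` sees the kernel equation, and on the constant the subtracted mean `K`
makes the product vanish. -/
lemma F_branch_eq_zero (h : IsSolutionOperator W S T) (hk : 0 < k) (g : ℝ) {t m : ℝ}
    {z : ℓ²(Idx, ℝ)} {u N : ℝ × ℝ →ᵇ ℝ} (hu : u = t • xiB k + t ^ 2 • S z) (hu1 : ‖u‖ < 1)
    (hN : N = (-1 / 4 : ℝ) • u ^ 2 + (11 / 48 : ℝ) • u ^ 3 + u ^ 4 * remainder u)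
    (e1 : t ^ 2 • z + (t ^ 2 * m / 4) • coeffs W u + (Mstar g k + t ^ 2 * m) • coeffs W N = 0)
    (e2 : t ^ 2 * m / 4 * kerFun k u + (Mstar g k + t ^ 2 * m) * kerFun k N = 0)
    (x : U k) (hx : (x : X k) = t • xi hk + t ^ 2 • T z) :
    F g x (Mstar g k + t ^ 2 * m) = 0 := by
  set M := Mstar g k + t ^ 2 * m with hM
  set c₀ : ℝ := 1 / 2 - Real.log 2
  have hfn : fn (x : X k) = toL2 k u := by rw [hx, h.fn_branch hk, hu]
  have hlap : lap (x : X k) = t ^ 2 • W z - k ^ 2 • toL2 k u := by rw [hx, h.lap_branch hk, hu]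
  have hnl : (fun p => nonlin (fn (x : X k) p)) =ᵐ[cellMeasure k]
      (c₀ • (1 : ℝ × ℝ →ᵇ ℝ) + (1 / 4 : ℝ) • u + N : ℝ × ℝ →ᵇ ℝ) := by
    rw [hfn]
    filter_upwards [coeFn_toL2 k u] with p hp
    rw [hp, nonlin_apply hu1 p, hN]
  have hone : (memLp_const (M * K x)).toLp = (M * K x) • toL2 k 1 := by
    rw [← map_smul]
    refine toL2_eq_toLp k _ _ (Eventually.of_forall fun p => ?_)
    change M * K x = M * K x * 1
    rw [mul_one]
  have hu0 : inner ℝ (toL2 k 1) (toL2 k u) = 0 := by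
    have h10 := inner_modeB_eq_zero hk (m := 0) (i := 1) le_rfl le_rfl le_rfl zero_le_one
      (by decide)
    have hS0 := h.inner_S_eq_zero hk (a := 0) (b := 0) le_rfl (by simp) z
    rw [hu, one_eq_modeB k, xiB]
    simp only [map_add, map_smul, inner_add_right, real_inner_smul_left, real_inner_smul_right,
      hS0]
    rw [Nat.cast_zero, h10]
    ring
  have hK : area k * K x = c₀ * area k + inner ℝ (toL2 k 1) (toL2 k N) := by
    rw [K, average_congr hnl, average_eq_inner hk]
    simp only [map_add, map_smul, inner_add_right, real_inner_smul_right, hu0, inner_one_one hk]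
    ring
  -- The linear terms collapse because `M/4 - g - k² = t² m / 4`.
  have hF : F g x M = t ^ 2 • W z + (t ^ 2 * m / 4) • toL2 k u + M • toL2 k N
      + (M * c₀ - M * K x) • toL2 k 1 := by
    rw [F, toL2_eq_toLp k _ (memLp_nonlin x) hnl, hone, hlap, hfn, map_add, map_add, map_smul,
      map_smul, hM, Mstar]
    module
  have hum : u ∈ modeAlg k := by
    rw [hu]
    exact add_mem (Subalgebra.smul_mem _ (xiB_mem_modeAlg k) _)
      (Subalgebra.smul_mem _ (h.S_mem z) _)
  have hNm : N ∈ modeAlg k := by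
    rw [hN]
    exact add_mem (add_mem (Subalgebra.smul_mem _ (pow_mem hum 2) _)
      (Subalgebra.smul_mem _ (pow_mem hum 3) _))
      (mul_mem (pow_mem hum 4) (remainder_mem hu1 _ (isClosed_modeAlg k) hum))
  rw [hF]
  refine eq_zero_of_mem_modeSpan ?_ fun i j hij => ?_
  · exact add_mem (add_mem (add_mem (Submodule.smul_mem _ _ (h.W_mem z))
      (Submodule.smul_mem _ _ (toL2_mem_modeSpan hum)))
      (Submodule.smul_mem _ _ (toL2_mem_modeSpan hNm)))
      (Submodule.smul_mem _ _ (toL2_mem_modeSpan (one_mem _)))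
  simp only [inner_add_right, real_inner_smul_right]
  by_cases h2 : 2 ≤ i ^ 2 + j ^ 2
  · set I : Idx := ⟨(i, j), hij, h2⟩
    have hI : modeB k i j = modeI k I := rfl
    have h0 : coeffs W 1 = 0 := by
      rw [one_eq_modeB k, map_smul, h.coeffs_modeB_eq_zero hk le_rfl (by simp), smul_zero]
    have e : t ^ 2 * z I + t ^ 2 * m / 4 * coeffs W u I + M * coeffs W N I = 0 :=
      congrArg (fun y : ℓ²(Idx, ℝ) => y I) e1
    rw [hI, h.inner_modeI_W hk, h.inner_modeI hk, h.inner_modeI hk, h.inner_modeI hk, h0,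
      lp.coeFn_zero, Pi.zero_apply]
    linear_combination ‖toL2 k (modeI k I)‖ * e
  · have hi : i ≤ 1 := by
      by_contra hc
      push Not at hc
      nlinarith
    push Not at h2
    rw [h.inner_W_eq_zero hk hij h2]
    interval_cases i
    · obtain rfl : j = 0 := by omega
      have h1 : ∀ y, inner ℝ (toL2 k (modeB k (0 : ℕ) (0 : ℕ))) y = 2 * inner ℝ (toL2 k 1) y := by
        intro y
        rw [one_eq_modeB k, map_smul, real_inner_smul_left]
        ring
      rw [h1, h1, h1, hu0, inner_one_one hk]
      linear_combination -2 * M * hK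
    · obtain rfl : j = 0 := by
        have : j ≤ 1 := hij
        interval_cases j
        · rfl
        · omega
      have h10 := inner_modeB_eq_zero hk (m := 1) (i := 0) le_rfl zero_le_one le_rfl le_rfl
        (by decide)
      have h1 : inner ℝ (toL2 k (modeB k (1 : ℕ) (0 : ℕ))) (toL2 k 1) = 0 := by
        rw [one_eq_modeB k, map_smul, real_inner_smul_right, Nat.cast_one, Nat.cast_zero, h10,
          mul_zero]
      rw [kerFun_eq, kerFun_eq] at e2
      rw [h1]
      linear_combination e2 / 2

/-- Pairing with `ξ₀` kills the `S`-part and leaves `4 t` times the area. -/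
lemma branch_ne_zero (h : IsSolutionOperator W S T) (hk : 0 < k) {t : ℝ} (ht : t ≠ 0)
    (z : ℓ²(Idx, ℝ)) : t • xi hk + t ^ 2 • T z ≠ 0 := by
  intro h0
  have h1 : fn (t • xi hk + t ^ 2 • T z) = 0 := by rw [h0]; rfl
  rw [h.fn_branch hk] at h1
  have h2 : kerFun k (t • xiB k + t ^ 2 • S z) = 0 := by rw [kerFun_apply, h1, inner_zero_right]
  rw [map_add, map_smul, map_smul, h.kerFun_S hk, kerFun_xiB hk, smul_zero, add_zero,
    smul_eq_mul] at h2
  have := area_pos hk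
  exact mul_ne_zero ht (by positivity) h2

end IsSolutionOperator

lemma F_zeroU (g : ℝ) {k : ℝ} (hk : 0 < k) (M : ℝ) : F g (zeroU k) M = 0 := by
  have h0 : fn (0 : X k) =ᵐ[cellMeasure k] 0 := Lp.coeFn_zero _ _ _
  have hnl : (fun p => nonlin (fn ((zeroU k : U k) : X k) p)) =ᵐ[cellMeasure k]
      (nonlin 0 • (1 : ℝ × ℝ →ᵇ ℝ) : ℝ × ℝ →ᵇ ℝ) := by
    filter_upwards [h0] with p hp
    exact (congrArg nonlin hp).trans (mul_one _).symm
  have hK : K (zeroU k) = nonlin 0 := by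
    apply mul_left_cancel₀ (area_pos hk).ne'
    rw [K, average_congr hnl, average_eq_inner hk, map_smul, real_inner_smul_right,
      inner_one_one hk, mul_comm]
  have hone : (memLp_const (M * K (zeroU k))).toLp = (M * K (zeroU k)) • toL2 k 1 := by
    rw [← map_smul]
    refine toL2_eq_toLp k _ _ (Eventually.of_forall fun p => ?_)
    exact (mul_one _).symm
  have hlap : lap ((zeroU k : U k) : X k) = 0 := add_zero (0 : L2per k)
  have hfn : fn ((zeroU k : U k) : X k) = 0 := rfl
  rw [F, toL2_eq_toLp k _ (memLp_nonlin _) hnl, hone, hlap, hfn, map_smul, hK]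
  module

end Branch

end ThinFilm

/-! ### The branch in the normalised parameter and its expansions. -/

theorem theorem5 (g k₀ : ℝ) (hg : 0 < g) (hk : 0 < k₀) :
    -- the trivial branch
    (∀ M : ℝ, ThinFilm.F g (ThinFilm.zeroU k₀) M = 0) ∧
    -- the bifurcating branch
    ∃ ε : ℝ, 0 < ε ∧ ∃ (v : ℝ → ThinFilm.U k₀) (M : ℝ → ℝ),
      ContinuousOn v (Ioo (-ε) ε) ∧ ContinuousOn M (Ioo (-ε) ε) ∧
      v 0 = ThinFilm.zeroU k₀ ∧ M 0 = ThinFilm.Mstar g k₀ ∧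
      (∀ s ∈ Ioo (-ε) ε, ThinFilm.F g (v s) (M s) = 0) ∧
      -- the solutions are nontrivial and subcritical away from the bifurcation point
      (∀ s ∈ Ioo (-ε) ε, s ≠ 0 →
        v s ≠ ThinFilm.zeroU k₀ ∧ M s < ThinFilm.Mstar g k₀) ∧
      -- the expansions
      (fun s : ℝ => (v s : ThinFilm.X k₀) - s • ThinFilm.xiHat hk)
        =O[𝓝 0] (fun s : ℝ => |s| ^ 2) ∧
      (fun s : ℝ => M s - (ThinFilm.Mstar g k₀
          - (g + k₀ ^ 2) * (104 * g + 203 * k₀ ^ 2)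
              / (48 * Real.pi ^ 2 * (1 + k₀ ^ 2 + k₀ ^ 4)) * s ^ 2))
        =O[𝓝 0] (fun s : ℝ => |s| ^ 3) := by
  classical
  refine ⟨ThinFilm.F_zeroU g hk, ?_⟩
  obtain ⟨W, S, T, h⟩ := ThinFilm.exists_solutionOperator hk
  obtain ⟨z, m, hz, hm, hm0, he⟩ := h.exists_reduced_branch hk g
  have hNsq := ThinFilm.norm_xi_sq hk
  set n : ℝ := ‖ThinFilm.xi hk‖ with hn
  have hnpos : 0 < n := by
    refine lt_of_le_of_ne (norm_nonneg _) fun h0 => ?_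
    rw [← h0] at hNsq
    have : 0 < 16 * Real.pi ^ 2 * (1 + k₀ ^ 2 + k₀ ^ 4) / k₀ ^ 2 := by positivity
    linarith
  have hm0neg : m 0 < 0 := by
    rw [hm0]
    have : 0 < (g + k₀ ^ 2) * (104 * g + 203 * k₀ ^ 2) / (3 * k₀ ^ 2) := by positivity
    linarith
  -- the properties of the branch in a neighbourhood of zero
  have hzc : ∀ᶠ t in 𝓝 0, ContinuousAt z t :=
    (hz.eventually (by simp)).mono fun t ht => ht.continuousAt
  have hmc : ∀ᶠ t in 𝓝 0, ContinuousAt m t :=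
    (hm.eventually (by simp)).mono fun t ht => ht.continuousAt
  have hmneg : ∀ᶠ t in 𝓝 0, m t < 0 := hm.continuousAt.eventually (eventually_lt_nhds hm0neg)
  have hsmall : ∀ᶠ t in 𝓝 0, ‖t • ThinFilm.xiB k₀ + t ^ 2 • S (z t)‖ < 1 := by
    have hc : ContinuousAt (fun t => ‖t • ThinFilm.xiB k₀ + t ^ 2 • S (z t)‖) 0 := by
      have := hz.continuousAt
      fun_prop
    exact hc.eventually (eventually_lt_nhds (by simp))
  obtain ⟨δ, hδ, hball⟩ := Metric.eventually_nhds_iff.1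
    (((he.and hzc).and hmc).and (hmneg.and hsmall))
  have hin : ∀ s ∈ Ioo (-(δ * n)) (δ * n), dist (s / n) 0 < δ := by
    intro s hs
    rw [dist_zero_right, norm_div, Real.norm_of_nonneg hnpos.le, div_lt_iff₀ hnpos]
    exact abs_lt.2 hs
  set x : ℝ → ThinFilm.X k₀ := fun t => t • ThinFilm.xi hk + t ^ 2 • T (z t) with hx
  have hxU : ∀ s ∈ Ioo (-(δ * n)) (δ * n), x (s / n) ∈ ThinFilm.U k₀ := fun s hs =>
    h.branch_mem_U hk (hball (hin s hs)).2.2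
  -- The value `zeroU` is only a default; on the interval the sup norm is below `1` and the first
  -- case applies.
  set v : ℝ → ThinFilm.U k₀ := fun s =>
    if hs : x (s / n) ∈ ThinFilm.U k₀ then ⟨x (s / n), hs⟩ else ThinFilm.zeroU k₀ with hv
  have hvx : ∀ s ∈ Ioo (-(δ * n)) (δ * n), (v s : ThinFilm.X k₀) = x (s / n) := fun s hs => by
    simp only [hv, dif_pos (hxU s hs)]
  have hε : 0 < δ * n := by positivity
  have h0mem : (0 : ℝ) ∈ Ioo (-(δ * n)) (δ * n) := ⟨by linarith, hε⟩
  have hnhds : Ioo (-(δ * n)) (δ * n) ∈ 𝓝 (0 : ℝ) := Ioo_mem_nhds h0mem.1 h0mem.2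
  have hdiv : Tendsto (fun s : ℝ => s / n) (𝓝 0) (𝓝 0) := by
    have : ContinuousAt (fun s : ℝ => s / n) 0 := by fun_prop
    simpa [ContinuousAt] using this
  have hsq : (fun s : ℝ => (s / n) ^ 2) =O[𝓝 0] fun s => |s| ^ 2 := by
    refine IsBigO.of_bound (1 / n ^ 2) (Eventually.of_forall fun s => le_of_eq ?_)
    rw [Real.norm_of_nonneg (by positivity), Real.norm_of_nonneg (by positivity), sq_abs]
    ring
  -- Normalising the direction to `ξ₀ / ‖ξ₀‖` amounts to the substitution `t = s / n`, so the radius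
  -- `δ` becomes `δ * n`.
  refine ⟨δ * n, hε, v, fun s => ThinFilm.Mstar g k₀ + (s / n) ^ 2 * m (s / n),
    ?_, ?_, ?_, ?_, ?_, ?_, ?_, ?_⟩
  · rw [Topology.IsInducing.subtypeVal.continuousOn_iff]
    refine ContinuousOn.congr (f := fun s => x (s / n)) (fun s hs => ?_) fun s hs => hvx s hs
    have h1 : ContinuousAt z (s / n) := (hball (hin s hs)).1.1.2
    have h2 : ContinuousAt x (s / n) := by rw [hx]; fun_prop
    exact (ContinuousAt.comp (g := x) (f := fun s => s / n) h2 (by fun_prop)).continuousWithinAt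
  · intro s hs
    have h1 : ContinuousAt m (s / n) := (hball (hin s hs)).1.2
    have h2 : ContinuousAt (fun s => m (s / n)) s := 
      ContinuousAt.comp (g := m) (f := fun s => s / n) h1 (by fun_prop)
    exact ContinuousAt.continuousWithinAt (by fun_prop)
  · refine Subtype.ext ?_
    rw [hvx 0 h0mem]
    simp [hx, ThinFilm.zeroU]
  · simp
  · intro s hs
    obtain ⟨e1, e2⟩ := (hball (hin s hs)).1.1.1 _ rfl _ rfl
    exact h.F_branch_eq_zero hk g rfl (hball (hin s hs)).2.2 rfl e1 e2 (v s) (hvx s hs)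
  · intro s hs hs0
    have ht : s / n ≠ 0 := div_ne_zero hs0 hnpos.ne'
    refine ⟨fun hc => h.branch_ne_zero hk ht (z (s / n)) ?_, ?_⟩
    · have := hvx s hs
      rw [hc] at this
      exact this.symm
    · have h1 : m (s / n) < 0 := (hball (hin s hs)).2.1
      have h2 : 0 < (s / n) ^ 2 := by positivity
      nlinarith
  · have hTz : (fun s => T (z (s / n))) =O[𝓝 0] fun _ => (1 : ℝ) := by
      have h1 : ContinuousAt (fun t => T (z t)) 0 := by
        have := hz.continuousAt
        fun_prop
      exact (h1.tendsto.comp hdiv).isBigO_one ℝ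
    refine (hsq.smul hTz).congr' ?_ ?_
    · filter_upwards [hnhds] with s hs
      rw [hvx s hs, ThinFilm.xiHat, ← hn, smul_smul, ← div_eq_mul_inv, hx]
      simp
    · exact Eventually.of_forall fun s => by simp
  -- Differentiability of `m` at `0` supplies the one extra order that turns the `s²` expansion into
  -- an error of order `|s|³`.
  · have hmO : (fun s => m (s / n) - m 0) =O[𝓝 0] fun s => |s| := by
      have h1 := ((hm.differentiableAt (by simp)).isBigO_sub).comp_tendsto hdiv
      refine h1.trans (IsBigO.of_bound (1 / n) (Eventually.of_forall fun s => le_of_eq ?_))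
      simp only [Function.comp_apply, sub_zero]
      rw [norm_div, Real.norm_of_nonneg hnpos.le, Real.norm_eq_abs, Real.norm_eq_abs, abs_abs]
      ring
    refine (hsq.mul hmO).congr' (Eventually.of_forall fun s => ?_)
      (Eventually.of_forall fun s => by ring)
    beta_reduce
    have hcoef : (g + k₀ ^ 2) * (104 * g + 203 * k₀ ^ 2)
        / (48 * Real.pi ^ 2 * (1 + k₀ ^ 2 + k₀ ^ 4)) = - m 0 / n ^ 2 := by
      rw [hm0, hNsq]
      field_simp
      ring
    rw [hcoef]
    ring
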